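/- **Setting.** Let $q$ be a prime power. For subspaces $X,Y$ of $\mathbb F_q^n$ put $d_S(X,Y)=\dim X+\dim Y-2\dim(X\cap Y)$ (subspace distance) and $d_I(X,Y)=\max\{\dim X,\dim Y\}-\dim(X\cap Y)$ (injection distance). *Identifying vectors and lifted FDMRD codes.* A binary vector $v$ of length $n$ and weight $k$ is the identifying vector of a $k$-dimensional subspace $X\subseteq\mathbb F_q^n$ if its ones are the pivot positions of the reduced row echelon form $\mathrm{RE}(X)$. The Ferrers diagram of $v$ consists of the positions of $\mathrm{RE}(X)$ in non-pivot columns to the right of the pivot of their row. For a diagram $\mathcal F$, an FDMRD code with rank distance $2$ is a linear space of matrices supported on $\mathcal F$, with $\operatorname{rank}(A-B)\ge 2$ for distinct members, of dimension $\min\{w_0,w_1\}$, where $w_0$ and $w_1$ are the numbers of dots of $\mathcal F$ outside the rightmost column and outside the first row, respectively. Lifting it means taking all subspaces with identifying vector $v$ whose entries in the Ferrers diagram are given by a member of the code. *Matching classes.* For $m\ge 3$ let $N=m$ if $m$ is odd and $N=m-1$ if $m$ is even. Let $P_i$ ($i$ read modulo $N$) be the set of weight-2 vectors in $\mathbb F_2^m$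 whose ones are at positions $a<b$ in $\{1,\dots,m\}$ such that either $b\le N$ and $a+b\equiv 2i \pmod N$, or $m$ is even, $b=m$ and $a\equiv i\pmod N$. (These are the classes of the circle (near) one-factorization of $K_m$.) **Construction C-5.** Let $n\ge 12$ and $n'=n-5$, and use the classes $P_i$ with $m=n'$. Let $$\begin{aligned} \mathcal A_0&=\{(11111\|0\cdots0)\},\\ \mathcal A_1&=\{(11100\|v),(10011\|v): v\in P_{\lceil n'/2\rceil+1}\},\\ \mathcal A_2&=\{(11010\|v),(01101\|v): v\in P_2\},\\ \mathcal A_3&=\{(01110\|v),(10101\|v): v\in P_{\lceil n'/2\rceil+2}\},\\ \mathcal A_4&=\{(00111\|v),(11001\|v): v\in P_3\},\\ \mathcal A_5&=\{(10110\|v),(01011\|v): v\in P_j,\ j\in J\}, \end{aligned}$$ $$J=\{\lceil n'/2\rceil+i:\ 3\le i\le \min\{\lceil q/2\rceil+2,\lfloor n'/2\rfloor\}\}\cup\{j:\ 4\le j\le\min\{\lfloor q/2\rfloor+3,\lceil n'/2\rceil\}\}.$$ For every $v\in\mathcal A_0\cup\dots\cup\mathcal A_4$ take a lifted FDMRD code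 with rank distance $2$ on the Ferrers diagram of $v$. For $v\in\mathcal A_5$ take an FDMRD code with rank distance $2$ on the Ferrers diagram without the leftmost dot of its first row (the pending dot), fill the pending dot with a fixed value of $\mathbb F_q$ depending only on the prefix and on the class $P_j$ of the suffix, with different values for different $j\in J$ and the same prefix, and lift. Finally add, with five zero columns in front of every codeword, a set $\mathbb D$ of $5$-dimensional subspaces of $\mathbb F_q^{n-5}$ with $d_I(Y,Z)\ge 2$ for distinct $Y,Z\in\mathbb D$, for example the largest known such code; write $A^*_q(n-5,2,5)=|\mathbb D|$. The union is the code $\mathbb C^5$. **Theorem.** Let $n\ge 12$. For every such $\mathbb D$ Construction C-5 can be carried out, and every code $\mathbb C^5$ obtained by it consists of $5$-dimensional subspaces of $\mathbb F_q^n$, has minimum subspace distance exactly $4$, and has cardinality as follows. If $n$ is even, $$\begin{aligned}|\mathbb C^5|={}&q^{4(n-5)}+(q^{2n-10}+q^{2n-14})\Big(q^{2(n-7)}+\tfrac{n-8}{2}q^{n-9}\Big)+(q^{2n-11}+q^{2n-13})\Big(\tfrac{n-8}{2}q^{n-10}+q^{2n-15}\Big)\\ &+(q^{2n-12}+q^{2n-13})\Big(2q^{2(n-8)}+\tfrac{n-10}{2}q^{n-11}\Big)\\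 &+(q^{2n-12}+q^{2n-14})\Bigg[\sum_{i=3}^{\min\{\lceil q/2\rceil+2,\lfloor n'/2\rfloor\}}\Big(iq^{2n-2i-12}+\big(\tfrac{n-6}{2}-i\big)q^{n-2i-7}\Big)\\ &\qquad+\sum_{i=2}^{\min\{\lfloor q/2\rfloor+2,\lceil n'/2\rceil-1\}}\Big(iq^{2n-2i-13}+\big(\tfrac{n-6}{2}-i\big)q^{n-2i-8}\Big)\Bigg]+A^*_q(n-5,2,5).\end{aligned}$$ If $n$ is odd, $$\begin{aligned}|\mathbb C^5|={}&q^{4(n-5)}+(q^{2n-10}+q^{2n-14})\Big(q^{2n-14}+\tfrac{n-9}{2}q^{n-8}+q^{\frac{n-9}{2}}\Big)+(q^{2n-11}+q^{2n-13})\Big(\tfrac{n-9}{2}q^{n-9}+q^{2n-15}+q^{n-8}\Big)\\ &+(q^{2n-12}+q^{2n-13})\Big(2q^{2n-16}+\tfrac{n-11}{2}q^{n-10}+q^{\frac{n-11}{2}}\Big)\\ &+(q^{2n-12}+q^{2n-14})\Bigg[\sum_{i=3}^{\min\{\lceil q/2\rceil+2,\lfloor n'/2\rfloor\}}\Big(iq^{2n-2i-12}+\big(\tfrac{n-7}{2}-i\big)q^{n-2i-6}+q^{\frac{n-7}{2}-i}\Big)\\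 &\qquad+\sum_{i=2}^{\min\{\lfloor q/2\rfloor+2,\lceil n'/2\rceil-1\}}\Big(iq^{2n-2i-13}+\big(\tfrac{n-7}{2}-i\big)q^{n-2i-7}+q^{n-i-7}\Big)\Bigg]+A^*_q(n-5,2,5).\end{aligned}$$ -/

import Mathlib

namespace SubspaceCodes

open Module

/-! ### Distances and minimum distance -/

section Distances

variable {F : Type*} [Field F] {n : ℕ}

/-- Subspace distance `dim X + dim Y - 2 dim (X ∩ Y)`. (The subtraction in `ℕ` never truncates,
since `dim (X ∩ Y)` is at most `dim X` and at most `dim Y`.) -/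
noncomputable def subspaceDist (X Y : Submodule F (Fin n → F)) : ℕ :=
  finrank F X + finrank F Y - 2 * finrank F (X ⊓ Y : Submodule F (Fin n → F))

/-- Injection distance `max {dim X, dim Y} - dim (X ∩ Y)`. -/
noncomputable def injectionDist (X Y : Submodule F (Fin n → F)) : ℕ :=
  max (finrank F X) (finrank F Y) - finrank F (X ⊓ Y : Submodule F (Fin n → F))

/-- The subspace distances of pairs of distinct codewords of `C`. -/
def subspaceDistances (C : Set (Submodule F (Fin n → F))) : Set ℕ :=
  {d | ∃ X ∈ C, ∃ Y ∈ C, X ≠ Y ∧ d = subspaceDist X Y}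

end Distances

/-! ### Identifying vectors and Ferrers diagrams

A binary vector `v : Fin n → ZMod 2` of weight `k` is the identifying vector of the `k × n` matrices
in reduced row echelon form whose pivot columns are the ones of `v`. Its Ferrers diagram is kept
in the positions of that matrix: the dots are the positions `(r, c)` such that `c` is not a pivot
column and lies to the right of the pivot of row `r`. Deleting the pivot columns does not change
the order of the rows and columns of the diagram, the number of its dots, or the rank of a matrix
supported on it. Rows are numbered from `0`. -/

section Ferrers

variable {n : ℕ}

/-- The number of ones of `v` strictly to the left of position `c`. The one of `v` at position `c`
is the pivot of row `onesBefore v c`; the pivot of row `r` lies to the left of the zero at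
position `c` if and only if `r < onesBefore v c`. -/
def onesBefore (v : Fin n → ZMod 2) (c : Fin n) : ℕ :=
  (Finset.univ.filter fun c' : Fin n => c' < c ∧ v c' = 1).card

/-- The Ferrers diagram of an identifying vector (of weight `k`). -/
def ferrers (k : ℕ) (v : Fin n → ZMod 2) : Finset (Fin k × Fin n) :=
  Finset.univ.filter fun p => v p.2 = 0 ∧ p.1.val < onesBefore v p.2

/-- The (one-element) set consisting of the leftmost dot in the first row of the Ferrers diagram
of `v`; this is the dot used as the pending dot. -/
def pendingDot (k : ℕ) (v : Fin n → ZMod 2) : Finset (Fin k × Fin n) :=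
  (ferrers k v).filter fun p =>
    p.1.val = 0 ∧ ∀ c : Fin n, (p.1, c) ∈ ferrers k v → p.2 ≤ c

/-- The number of dots of the diagram `S` that are neither in its first `i` rows nor in its
rightmost `d - 1 - i` columns (only columns that contain a dot are columns of the diagram). -/
def dotsRemaining {k : ℕ} (S : Finset (Fin k × Fin n)) (d i : ℕ) : ℕ :=
  (S.filter fun p =>
    i ≤ p.1.val ∧ d - 1 - i ≤ ((S.image Prod.snd).filter fun c => p.2 < c).card).card

/-- `C` is a Ferrers diagram maximum rank distance (FDMRD) code with diagram `S` and minimum rank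
distance (at least) `d`: a linear code of matrices that vanish outside `S`, in which any two
distinct codewords have rank distance at least `d`, and whose dimension attains the upper bound
`min_{0 ≤ i ≤ d - 1} w_i`, where `w_i = dotsRemaining S d i`. -/
def IsFDMRD {F : Type*} [Field F] {k : ℕ} (S : Finset (Fin k × Fin n)) (d : ℕ)
    (C : Submodule F (Matrix (Fin k) (Fin n) F)) : Prop :=
  (∀ A ∈ C, ∀ r c, (r, c) ∉ S → A r c = 0) ∧
  (∀ A ∈ C, ∀ B ∈ C, A ≠ B → d ≤ (A - B).rank) ∧
  IsLeast {w : ℕ | ∃ i < d, w = dotsRemaining S d i} (finrank F C)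

/-- The `k × n` matrix in reduced row echelon form with identifying vector `v` whose entries on the
Ferrers diagram of `v` are those of `A`. -/
def echelon {F : Type*} [Field F] {k : ℕ} (v : Fin n → ZMod 2)
    (A : Matrix (Fin k) (Fin n) F) : Matrix (Fin k) (Fin n) F :=
  Matrix.of fun r c =>
    if (r, c) ∈ ferrers k v then A r c
    else if v c = 1 ∧ onesBefore v c = r.val then 1 else 0

/-- The subspace with identifying vector `v` and Ferrers tableaux form given by `A`: the row space
of the corresponding matrix in reduced row echelon form. -/
def lift {F : Type*} [Field F] {k : ℕ} (v : Fin n → ZMod 2)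
    (A : Matrix (Fin k) (Fin n) F) : Submodule F (Fin n → F) :=
  Submodule.span F (Set.range (echelon v A).row)

/-- The matrix `A` with the value `a` put on the pending dot of `v`. -/
def withPending {F : Type*} [Field F] {k : ℕ} (v : Fin n → ZMod 2) (a : F)
    (A : Matrix (Fin k) (Fin n) F) : Matrix (Fin k) (Fin n) F :=
  Matrix.of fun r c => if (r, c) ∈ pendingDot k v then a else A r c

end Ferrers

/-! ### The (near) one-factorization of the complete graph -/

section Matchings

/-- The vector of length `m` with ones exactly at the positions `a` and `b` (positions are
numbered `1, …, m`). -/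
def edgeVector (m a b : ℕ) : Fin m → ZMod 2 :=
  fun p => if p.val + 1 = a ∨ p.val + 1 = b then 1 else 0

/-- The number of nodes on the circle: all `m` nodes if `m` is odd; if `m` is even, the node `m`
is the centre of the circle. It is also the number of classes. -/
def circleSize (m : ℕ) : ℕ := if Even m then m - 1 else m

/-- The class `P_i` of the circle (near) one-factorization of the complete graph on the nodes
`1, …, m`, as a set of weight-two vectors. Two chords of the circle are parallel if and only if
their sums of end points agree modulo the number of nodes on the circle. For odd `m`, `P_i` is the
class of parallel chords that leaves out node `i`; for even `m` it consists of the edge `(i, m)`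
to the centre and the chords orthogonal to it. The index `i`, being the label of a node of the
circle, is read cyclically. -/
def matchingClass (m i : ℕ) : Set (Fin m → ZMod 2) :=
  {s | ∃ a b : ℕ, 1 ≤ a ∧ a < b ∧ b ≤ m ∧ s = edgeVector m a b ∧
    ((b ≤ circleSize m ∧ a + b ≡ 2 * i [MOD circleSize m]) ∨
     (circleSize m < b ∧ a ≡ i [MOD circleSize m]))}

end Matchings

/-! ### Construction C-5 -/

section Construction

/-- The concatenation `(u || s)` of a prefix of length `5` and a suffix of length `n - 5`. -/
def concat (n : ℕ) (u : Fin 5 → ZMod 2) (s : Fin (n - 5) → ZMod 2) : Fin n → ZMod 2 :=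
  fun p => if h : p.val < 5 then u ⟨p.val, h⟩ else s ⟨p.val - 5, by omega⟩

/-- The identifying vectors with a prefix in `U` and a suffix in the class `P_i` of the
(near) one-factorization of the complete graph on `n' = n - 5` nodes. -/
def idVectors (n : ℕ) (U : Set (Fin 5 → ZMod 2)) (i : ℕ) : Set (Fin n → ZMod 2) :=
  {v | ∃ u ∈ U, ∃ s ∈ matchingClass (n - 5) i, v = concat n u s}

/-- `⌈m / 2⌉`. -/
def ceilHalf (m : ℕ) : ℕ := (m + 1) / 2

/-- `⌊m / 2⌋`. -/
def floorHalf (m : ℕ) : ℕ := m / 2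

/-- `𝒜₀`: the identifying vector `(11111 || 0…0)` of the lifted MRD code. -/
def idA0 (n : ℕ) : Set (Fin n → ZMod 2) := {concat n ![1, 1, 1, 1, 1] 0}

/-- `𝒜₁`. -/
def idA1 (n : ℕ) : Set (Fin n → ZMod 2) :=
  idVectors n {![1, 1, 1, 0, 0], ![1, 0, 0, 1, 1]} (ceilHalf (n - 5) + 1)

/-- `𝒜₂`. -/
def idA2 (n : ℕ) : Set (Fin n → ZMod 2) :=
  idVectors n {![1, 1, 0, 1, 0], ![0, 1, 1, 0, 1]} 2

/-- `𝒜₃`. -/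
def idA3 (n : ℕ) : Set (Fin n → ZMod 2) :=
  idVectors n {![0, 1, 1, 1, 0], ![1, 0, 1, 0, 1]} (ceilHalf (n - 5) + 2)

/-- `𝒜₄`. -/
def idA4 (n : ℕ) : Set (Fin n → ZMod 2) :=
  idVectors n {![0, 0, 1, 1, 1], ![1, 1, 0, 0, 1]} 3

/-- The two prefixes of `𝒜₅`. -/
def prefixesA5 : Set (Fin 5 → ZMod 2) := {![1, 0, 1, 1, 0], ![0, 1, 0, 1, 1]}

/-- The indices of the classes that serve as suffixes in `𝒜₅`. -/
def indicesA5 (q n : ℕ) : Set ℕ :=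
  {j | ∃ i, 3 ≤ i ∧ i ≤ min (ceilHalf q + 2) (floorHalf (n - 5)) ∧
      j = ceilHalf (n - 5) + i} ∪
  {j | 4 ≤ j ∧ j ≤ min (floorHalf q + 3) (ceilHalf (n - 5))}

/-- `𝒜₅`. -/
def idA5 (q n : ℕ) : Set (Fin n → ZMod 2) :=
  {v | ∃ j ∈ indicesA5 q n, v ∈ idVectors n prefixesA5 j}

/-- The linear map `𝔽^(n-5) → 𝔽^n` that puts five zeros in front of a vector. -/
def prependZeros (F : Type*) [Field F] (n : ℕ) : (Fin (n - 5) → F) →ₗ[F] (Fin n → F) where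
  toFun y := fun p => if h : p.val < 5 then 0 else y ⟨p.val - 5, by omega⟩
  map_add' y z := by
    funext p
    by_cases h : p.val < 5 <;> simp [h]
  map_smul' t y := by
    funext p
    by_cases h : p.val < 5 <;> simp [h]

/-- `C` is a code obtained by Construction C-5 from the code `D` in `𝔽^(n-5)`. The choices in the
construction are
* for every identifying vector `v` an FDMRD code `fd v` with rank distance `2`, on the Ferrers
  diagram of `v` if `v ∈ 𝒜₀ ∪ … ∪ 𝒜₄`, and on the Ferrers diagram without its pending dot if
  `v ∈ 𝒜₅`;
* for every prefix `u` of `𝒜₅` and every class `P_j` used in `𝒜₅` a value `a u j` for the pending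
  dot, different classes getting different values.
The code is the union of the lifted FDMRD codes and of `D` with five zero columns in front. -/
def IsConstructionC5 {F : Type*} [Field F] (n : ℕ) (D : Set (Submodule F (Fin (n - 5) → F)))
    (C : Set (Submodule F (Fin n → F))) : Prop :=
  ∃ (fd : (Fin n → ZMod 2) → Submodule F (Matrix (Fin 5) (Fin n) F))
    (a : (Fin 5 → ZMod 2) → ℕ → F),
    (∀ v ∈ idA0 n ∪ idA1 n ∪ idA2 n ∪ idA3 n ∪ idA4 n, IsFDMRD (ferrers 5 v) 2 (fd v)) ∧
    (∀ v ∈ idA5 (Nat.card F) n, IsFDMRD (ferrers 5 v \ pendingDot 5 v) 2 (fd v)) ∧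
    (∀ u ∈ prefixesA5, Set.InjOn (a u) (indicesA5 (Nat.card F) n)) ∧
    C = {X | ∃ v ∈ idA0 n ∪ idA1 n ∪ idA2 n ∪ idA3 n ∪ idA4 n, ∃ A ∈ fd v, X = lift v A} ∪
        {X | ∃ u ∈ prefixesA5, ∃ j ∈ indicesA5 (Nat.card F) n, ∃ s ∈ matchingClass (n - 5) j,
          ∃ A ∈ fd (concat n u s),
            X = lift (concat n u s) (withPending (concat n u s) (a u j) A)} ∪
        {X | ∃ Y ∈ D, X = Y.map (prependZeros F n)}

end Construction

end SubspaceCodes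

/-!
The identifying vector of a codeword records its pivot positions, and the first nonzero entry of any
vector of a subspace sits at a pivot. Hence the dimension of `X ⊓ Y` is at most the number of common
pivots (`finrank_le_card_common_pivots`), and a pair of codewords has subspace distance at least `4`
once they have at most three common pivots. For codewords with different identifying vectors
this is ensured by the prefixes together with the suffixes: prefixes in the same `𝒜_i` have at most
one common one, other prefixes at most two, edges in one class are disjoint
(`eq_of_mem_edges_of_common`) and different classes have no common edge (`index_eq_of_mem_edges`).
The only exception is a pair of codewords of `𝒜₅` with the same prefix and suffixes from different
classes, which may have four common pivots; there the different values on the pending dot force a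
common vector to vanish at the first pivot (`finrank_inf_le_of_pending`). For equal identifying
vectors the dimension of the intersection is at most `5` minus the rank of the difference of the
matrices (`finrank_inf_lift_add_rank_le`). Distance exactly `4` occurs in the lifted MRD code, which
by dimension count contains a nonzero matrix with only two nonzero rows.

The codes used by the construction exist because every diagram involved has a first row at least as
long as the number of rows, and its other rows lie below this first row: the matrices with
`∑ θ_r * row_r = 0`, the rows being read in a field extension, form an FDMRD code
(`exists_isFDMRD`). For such diagrams the bound on the dimension is the number of dots outside the
first row. For a prefix of weight three and the edge `(a, b)` this number is `4 n - 25 - (a + b)`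
plus a constant depending on the prefix only (`dotsRemaining_diagram`), so that the cardinality
comes down to counting the edges `(a, b)` of a class according to the value of `a + b`, of which
there are at most two for the chords, and one more edge to the centre if `n - 5` is even
(`sum_edges_odd`, `sum_edges_even`). The term with summation index `i = 2` in the second sum of the
formula is the contribution of `𝒜₄`.
-/

namespace SubspaceCodes

open Module

/-! ### Subspaces with a given identifying vector -/

section Lifts

variable {n : ℕ}

/-- The pivot positions, i.e. the positions of the ones, of an identifying vector. -/
def pivots (v : Fin n → ZMod 2) : Finset (Fin n) :=
  Finset.univ.filter fun c => v c = 1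

lemma mem_pivots {v : Fin n → ZMod 2} {c : Fin n} : c ∈ pivots v ↔ v c = 1 := by
  simp [pivots]

lemma onesBefore_eq (v : Fin n → ZMod 2) (c : Fin n) :
    onesBefore v c = ((pivots v).filter fun c' => c' < c).card := by
  unfold onesBefore pivots
  congr 1
  ext x
  simp [and_comm]

lemma onesBefore_mono (v : Fin n → ZMod 2) {c c' : Fin n} (h : c ≤ c') :
    onesBefore v c ≤ onesBefore v c' := by
  rw [onesBefore_eq, onesBefore_eq]
  apply Finset.card_le_card
  intro x hx
  simp only [Finset.mem_filter] at hx ⊢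
  exact ⟨hx.1, hx.2.trans_le h⟩

lemma onesBefore_lt_of_pivot {v : Fin n → ZMod 2} {c c' : Fin n} (hc : v c = 1) (h : c < c') :
    onesBefore v c < onesBefore v c' := by
  rw [onesBefore_eq, onesBefore_eq]
  apply Finset.card_lt_card
  refine Finset.ssubset_iff_subset_ne.2 ⟨?_, ?_⟩
  · intro x hx
    simp only [Finset.mem_filter] at hx ⊢
    exact ⟨hx.1, hx.2.trans h⟩
  · intro he
    have : c ∈ (pivots v).filter fun x => x < c := by
      rw [he]; simp [mem_pivots, hc, h]
    simp at this

lemma onesBefore_le_card (v : Fin n → ZMod 2) (c : Fin n) :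
    onesBefore v c ≤ (pivots v).card := by
  rw [onesBefore_eq]
  exact Finset.card_filter_le _ _

lemma onesBefore_lt_card {v : Fin n → ZMod 2} {c : Fin n} (hc : v c = 1) :
    onesBefore v c < (pivots v).card := by
  rw [onesBefore_eq]
  apply Finset.card_lt_card
  refine Finset.filter_ssubset.2 ⟨c, mem_pivots.2 hc, by simp⟩

/-- Every row of a matrix in reduced row echelon form has a pivot. -/
lemma exists_pivot_of_row {v : Fin n → ZMod 2} {k : ℕ} (hk : (pivots v).card = k) (r : Fin k) :
    ∃ c, v c = 1 ∧ onesBefore v c = r.val := by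
  have hinj : Set.InjOn (onesBefore v) (pivots v) := by
    intro c hc c' hc' h
    have hc := mem_pivots.1 hc
    have hc' := mem_pivots.1 hc'
    rcases lt_trichotomy c c' with hl | hl | hl
    · exact absurd h (onesBefore_lt_of_pivot hc hl).ne
    · exact hl
    · exact absurd h (onesBefore_lt_of_pivot hc' hl).ne'
  have himg : (pivots v).image (onesBefore v) = Finset.range k := by
    apply Finset.eq_of_subset_of_card_le
    · intro x hx
      obtain ⟨c, hc, rfl⟩ := Finset.mem_image.1 hx
      exact Finset.mem_range.2 (hk ▸ onesBefore_lt_card (mem_pivots.1 hc))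
    · rw [Finset.card_image_of_injOn hinj, hk, Finset.card_range]
  have : r.val ∈ (pivots v).image (onesBefore v) := by
    rw [himg]; exact Finset.mem_range.2 r.2
  obtain ⟨c, hc, h⟩ := Finset.mem_image.1 this
  exact ⟨c, mem_pivots.1 hc, h⟩

variable {F : Type*} [Field F] {k : ℕ}

lemma mem_ferrers {v : Fin n → ZMod 2} {r : Fin k} {c : Fin n} :
    (r, c) ∈ ferrers k v ↔ v c = 0 ∧ r.val < onesBefore v c := by
  simp [ferrers]

lemma echelon_pivot {v : Fin n → ZMod 2} (A : Matrix (Fin k) (Fin n) F) {c : Fin n}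
    (hc : v c = 1) (r : Fin k) :
    echelon v A r c = if onesBefore v c = r.val then 1 else 0 := by
  simp [echelon, mem_ferrers, hc]

lemma echelon_of_not_pivot {v : Fin n → ZMod 2} (A : Matrix (Fin k) (Fin n) F) {c : Fin n}
    (hc : v c ≠ 1) (r : Fin k) :
    echelon v A r c = if r.val < onesBefore v c then A r c else 0 := by
  have h0 : v c = 0 := by
    generalize v c = z at hc
    revert hc; revert z; decide
  simp [echelon, mem_ferrers, h0]

lemma mem_lift {v : Fin n → ZMod 2} {A : Matrix (Fin k) (Fin n) F} {x : Fin n → F} :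
    x ∈ lift v A ↔ ∃ l : Fin k → F, Matrix.vecMul l (echelon v A) = x := by
  unfold lift
  rw [← range_vecMulLinear]
  simp [LinearMap.mem_range]

lemma vecMul_echelon_pivot {v : Fin n → ZMod 2} (A : Matrix (Fin k) (Fin n) F) (l : Fin k → F)
    {c : Fin n} (hc : v c = 1) {r : Fin k} (hr : onesBefore v c = r.val) :
    Matrix.vecMul l (echelon v A) c = l r := by
  simp only [Matrix.vecMul, dotProduct, echelon_pivot A hc, hr]
  simp [Fin.val_inj]

lemma vecMul_echelon_injective {v : Fin n → ZMod 2} (hk : (pivots v).card = k)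
    (A : Matrix (Fin k) (Fin n) F) :
    Function.Injective (fun l : Fin k → F => Matrix.vecMul l (echelon v A)) := by
  intro l l' h
  funext r
  obtain ⟨c, hc, hr⟩ := exists_pivot_of_row hk r
  have := congrFun h c
  simpa only [vecMul_echelon_pivot A _ hc hr] using this

lemma finrank_lift {v : Fin n → ZMod 2} (hk : (pivots v).card = k)
    (A : Matrix (Fin k) (Fin n) F) : finrank F (lift v A) = k := by
  unfold lift
  rw [← range_vecMulLinear, LinearMap.finrank_range_of_inj, Module.finrank_fin_fun]
  exact vecMul_echelon_injective hk A

/-- The first nonzero entry of an element of a subspace is at a pivot position. -/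
lemma apply_eq_zero_of_leading {v : Fin n → ZMod 2} (hk : (pivots v).card = k)
    {A : Matrix (Fin k) (Fin n) F} {x : Fin n → F} (hx : x ∈ lift v A) {c : Fin n}
    (hlead : ∀ c' < c, x c' = 0) (hc : v c ≠ 1) : x c = 0 := by
  obtain ⟨l, rfl⟩ := mem_lift.1 hx
  simp only [Matrix.vecMul, dotProduct]
  apply Finset.sum_eq_zero
  intro r _
  rw [echelon_of_not_pivot A hc]
  split_ifs with h
  · obtain ⟨p, hp, hr⟩ := exists_pivot_of_row hk r
    have hpc : p < c := by
      by_contra hle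
      have := onesBefore_mono v (not_lt.1 hle)
      omega
    have := hlead p hpc
    rw [vecMul_echelon_pivot A l hp hr] at this
    rw [this, zero_mul]
  · rw [mul_zero]

/-- The dimension of a space of common vectors is bounded by the number of common pivot positions;
common pivot positions at which all these vectors vanish need not be counted. -/
lemma finrank_le_card_common_pivots {v w : Fin n → ZMod 2} {l : ℕ} (hv : (pivots v).card = k)
    (hw : (pivots w).card = l) {A : Matrix (Fin k) (Fin n) F} {B : Matrix (Fin l) (Fin n) F}
    (Z : Submodule F (Fin n → F)) (hZ : Z ≤ lift v A ⊓ lift w B) (T : Finset (Fin n))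
    (hT : ∀ x ∈ Z, ∀ c, v c = 1 → w c = 1 → c ∉ T → x c = 0) :
    finrank F Z ≤ T.card := by
  let f : Z →ₗ[F] (T → F) :=
    (LinearMap.funLeft F F (fun t : T => (t : Fin n))).comp Z.subtype
  have hf : Function.Injective f := by
    rw [← LinearMap.ker_eq_bot, LinearMap.ker_eq_bot']
    rintro ⟨x, hx⟩ h
    have hxT : ∀ c ∈ T, x c = 0 := fun c hc => congrFun h ⟨c, hc⟩
    have key : ∀ m : ℕ, ∀ c : Fin n, c.val = m → x c = 0 := by
      intro m
      induction m using Nat.strong_induction_on with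
      | _ m ih =>
        intro c hcm
        have hlead : ∀ c' < c, x c' = 0 := fun c' hc' => ih c'.val (by
          have := Fin.lt_def.1 hc'; omega) c' rfl
        by_cases h1 : v c = 1
        · by_cases h2 : w c = 1
          · by_cases h3 : c ∈ T
            · exact hxT c h3
            · exact hT x hx c h1 h2 h3
          · exact apply_eq_zero_of_leading hw (hZ hx).2 hlead h2
        · exact apply_eq_zero_of_leading hv (hZ hx).1 hlead h1
    ext c
    exact key _ c rfl
  have := LinearMap.finrank_le_finrank_of_injective hf
  simpa using this

lemma finrank_inf_lift_le_card_inter {v w : Fin n → ZMod 2} (hv : (pivots v).card = k)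
    (hw : (pivots w).card = k) (A B : Matrix (Fin k) (Fin n) F) :
    finrank F (lift v A ⊓ lift w B : Submodule F (Fin n → F)) ≤ (pivots v ∩ pivots w).card :=
  finrank_le_card_common_pivots hv hw _ le_rfl _ fun _ _ _ h1 h2 h3 =>
    absurd (Finset.mem_inter.2 ⟨mem_pivots.2 h1, mem_pivots.2 h2⟩) h3

/-- For equal identifying vectors, the coefficient vector of a common vector is annihilated by the
difference of the two Ferrers tableaux forms. -/
lemma finrank_inf_lift_add_rank_le {v : Fin n → ZMod 2} (hk : (pivots v).card = k)
    {A B : Matrix (Fin k) (Fin n) F} (hA : ∀ r c, (r, c) ∉ ferrers k v → A r c = 0)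
    (hB : ∀ r c, (r, c) ∉ ferrers k v → B r c = 0) :
    finrank F (lift v A ⊓ lift v B : Submodule F (Fin n → F)) + (A - B).rank ≤ k := by
  have hsub : ∀ r c, echelon v A r c - echelon v B r c = (A - B) r c := by
    intro r c
    by_cases h : (r, c) ∈ ferrers k v
    · simp [echelon, h]
    · simp [echelon, h, hA r c h, hB r c h]
  have hle : lift v A ⊓ lift v B ≤
      (LinearMap.ker (A - B).vecMulLinear).map (echelon v A).vecMulLinear := by
    rintro x ⟨hxA, hxB⟩
    obtain ⟨l, rfl⟩ := mem_lift.1 hxA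
    obtain ⟨l', hl'⟩ := mem_lift.1 hxB
    have hll : l' = l := by
      funext r
      obtain ⟨c, hc, hr⟩ := exists_pivot_of_row hk r
      have := congrFun hl' c
      rwa [vecMul_echelon_pivot B _ hc hr, vecMul_echelon_pivot A _ hc hr] at this
    subst hll
    refine ⟨l', ?_, rfl⟩
    simp only [SetLike.mem_coe, LinearMap.mem_ker, Matrix.vecMulLinear_apply]
    have he : A - B = echelon v A - echelon v B := by
      ext r c; rw [← hsub]; rfl
    rw [he, Matrix.vecMul_sub, hl', sub_self]
  have h1 := (Submodule.finrank_mono hle).trans (Submodule.finrank_map_le _ _)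
  have h2 := LinearMap.finrank_range_add_finrank_ker (A - B).vecMulLinear
  rw [range_vecMulLinear, ← Matrix.rank_eq_finrank_span_row, Module.finrank_fin_fun] at h2
  omega

/-- Rows in which two Ferrers tableaux forms agree give common basis vectors of the subspaces. -/
lemma card_le_finrank_inf_lift {v : Fin n → ZMod 2} (hk : (pivots v).card = k)
    {A B : Matrix (Fin k) (Fin n) F} (R : Finset (Fin k)) (hR : ∀ r ∈ R, ∀ c, A r c = B r c) :
    R.card ≤ finrank F (lift v A ⊓ lift v B : Submodule F (Fin n → F)) := by
  have hrow : ∀ r ∈ R, (echelon v A).row r = (echelon v B).row r := by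
    intro r hr
    funext c
    simp [Matrix.row, echelon, hR r hr c]
  have hli : LinearIndependent F (echelon v A).row :=
    Matrix.vecMul_injective_iff.1 (vecMul_echelon_injective hk A)
  have hli' : LinearIndependent F (fun r : R => (echelon v A).row r) :=
    hli.comp _ Subtype.val_injective
  have hspan := finrank_span_eq_card hli'
  rw [Fintype.card_coe] at hspan
  rw [← hspan]
  apply Submodule.finrank_mono
  rw [Submodule.span_le]
  rintro _ ⟨r, rfl⟩
  refine ⟨Submodule.subset_span ⟨r, rfl⟩, ?_⟩
  simp only
  rw [hrow r r.2]
  exact Submodule.subset_span ⟨r, rfl⟩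

/-- In a column to the right of the first pivot only, an element of a subspace is determined by
its entry at that pivot. -/
lemma apply_eq_mul_of_onesBefore_eq_one {v : Fin n → ZMod 2} {A : Matrix (Fin (k + 1)) (Fin n) F}
    {x : Fin n → F} (hx : x ∈ lift v A) {p c : Fin n} (hp : v p = 1) (hp0 : onesBefore v p = 0)
    (hc : v c ≠ 1) (hc1 : onesBefore v c = 1) : x c = x p * A 0 c := by
  obtain ⟨l, rfl⟩ := mem_lift.1 hx
  rw [vecMul_echelon_pivot A l hp (r := 0) (by simpa using hp0)]
  simp only [Matrix.vecMul, dotProduct, echelon_of_not_pivot A hc, hc1]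
  rw [Finset.sum_eq_single 0]
  · simp
  · intro r _ hr
    have : ¬ r.val < 1 := by
      intro h
      exact hr (Fin.ext (by simpa using h))
    simp [this]
  · simp

end Lifts

/-! ### Ferrers diagram codes with rank distance two -/

section Existence

variable {n k : ℕ}

lemma dotsRemaining_two_one (S : Finset (Fin k × Fin n)) :
    dotsRemaining S 2 1 = (S.filter fun p => 1 ≤ p.1.val).card := by
  simp [dotsRemaining]

/-- The number of dots in the rightmost column is at most the number of rows. -/
lemma card_le_dotsRemaining_two_zero_add (S : Finset (Fin k × Fin n)) :
    S.card ≤ dotsRemaining S 2 0 + k := by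
  unfold dotsRemaining
  rw [← Finset.card_filter_add_card_filter_not (s := S)
    (p := fun p => 0 ≤ p.1.val ∧ 2 - 1 - 0 ≤ ((S.image Prod.snd).filter fun c => p.2 < c).card)]
  gcongr
  refine (Finset.card_le_card_of_injOn (t := Finset.univ) Prod.fst (by simp) ?_).trans_eq
    (by simp)
  rintro ⟨r, c⟩ h ⟨r', c'⟩ h' (rfl : r = r')
  -- both dots have no column of the diagram to their right
  have key : ∀ p ∈ S, ¬ (0 ≤ p.1.val ∧
      2 - 1 - 0 ≤ ((S.image Prod.snd).filter fun c => p.2 < c).card) →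
      ∀ t ∈ S, ¬ p.2 < t.2 := by
    intro p _ hp t ht hlt
    apply hp
    refine ⟨Nat.zero_le _, Finset.card_pos.2 ⟨t.2, ?_⟩⟩
    simp only [Finset.mem_filter, Finset.mem_image]
    exact ⟨⟨t, ht, rfl⟩, hlt⟩
  simp only [Finset.coe_filter, Set.mem_ofPred_eq] at h h'
  have h1 := key _ h.1 h.2 _ h'.1
  have h2 := key _ h'.1 h'.2 _ h.1
  simp only at h1 h2
  rw [le_antisymm (not_lt.1 h2) (not_lt.1 h1)]

lemma card_filter_first_row_add (S : Finset (Fin (k + 1) × Fin n)) :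
    (S.filter fun p => p.1 = 0).card + dotsRemaining S 2 1 = S.card := by
  rw [dotsRemaining_two_one, ← Finset.card_filter_add_card_filter_not (s := S)
    (p := fun p => p.1 = 0)]
  congr 2
  apply Finset.filter_congr
  intro p _
  rw [Fin.ext_iff]
  simp only [Fin.val_zero]
  omega

/-- If the first row of a diagram has at least as many dots as there are rows, then the bound on
the dimension of an FDMRD code with rank distance `2` is the number of dots outside the first
row. -/
lemma isLeast_dotsRemaining_iff {S : Finset (Fin (k + 1) × Fin n)}
    (hS : k + 1 ≤ (S.filter fun p => p.1 = 0).card) (d : ℕ) :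
    IsLeast {w : ℕ | ∃ i < 2, w = dotsRemaining S 2 i} d ↔ d = dotsRemaining S 2 1 := by
  have h0 := card_le_dotsRemaining_two_zero_add S
  have h1 := card_filter_first_row_add S
  have hl : IsLeast {w : ℕ | ∃ i < 2, w = dotsRemaining S 2 i} (dotsRemaining S 2 1) := by
    refine ⟨⟨1, by norm_num, rfl⟩, ?_⟩
    rintro w ⟨i, hi, rfl⟩
    interval_cases i
    · omega
    · exact le_rfl
  exact ⟨fun h => h.unique hl, fun h => h ▸ hl⟩

variable {F : Type*} [Field F]

lemma exists_field_extension (F : Type*) [Field F] [Finite F] (N : ℕ) (hN : N ≠ 0) :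
    ∃ (L : Type) (_ : Field L) (_ : Algebra F L), Module.Finite F L ∧ finrank F L = N := by
  obtain ⟨p, hp⟩ := CharP.exists F
  have : Fact p.Prime := ⟨CharP.char_is_prime F p⟩
  have : NeZero N := ⟨hN⟩
  exact ⟨FiniteField.Extension F p N, inferInstance, inferInstance, inferInstance,
    FiniteField.finrank_extension F p N⟩

/-- A matrix of rank at most one is a column times a row. -/
lemma exists_eq_mul_of_rank_lt_two {A : Matrix (Fin k) (Fin n) F} (h : A.rank < 2) :
    ∃ (l : Fin k → F) (x : Fin n → F), ∀ r c, A r c = l r * x c := by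
  rw [Matrix.rank_eq_finrank_span_row] at h
  obtain ⟨⟨x, hx⟩, hx'⟩ := finrank_le_one_iff.1 (Nat.lt_succ_iff.1 h)
  have : ∀ r, ∃ a : F, a • x = A.row r := by
    intro r
    obtain ⟨a, ha⟩ := hx' ⟨A.row r, Submodule.subset_span ⟨r, rfl⟩⟩
    exact ⟨a, congrArg Subtype.val ha⟩
  choose l hl using this
  refine ⟨l, x, fun r c => ?_⟩
  have := congrFun (hl r) c
  simpa [Matrix.row] using this.symm

/-- Extension by zero of a filling of the diagram `S` to a matrix. -/
def matrixOfDiagram (F : Type*) [Field F] (S : Finset (Fin k × Fin n)) :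
    (S → F) →ₗ[F] Matrix (Fin k) (Fin n) F where
  toFun f := Matrix.of fun r c => if h : (r, c) ∈ S then f ⟨(r, c), h⟩ else 0
  map_add' f g := by
    ext r c
    by_cases h : (r, c) ∈ S <;> simp [h]
  map_smul' t f := by
    ext r c
    by_cases h : (r, c) ∈ S <;> simp [h]

lemma matrixOfDiagram_apply_mem (S : Finset (Fin k × Fin n)) (f : S → F) (p : S) :
    matrixOfDiagram F S f p.1.1 p.1.2 = f p := by
  simp [matrixOfDiagram]

lemma matrixOfDiagram_apply_notMem (S : Finset (Fin k × Fin n)) (f : S → F) {r : Fin k}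
    {c : Fin n} (h : (r, c) ∉ S) : matrixOfDiagram F S f r c = 0 := by
  simp [matrixOfDiagram, h]

/-- Ferrers diagram codes attaining the bound for rank distance `2` exist whenever every column
has a dot in the first row and the first row is at least as long as the number of rows. With a
field extension `L` whose degree is the length of the first row, the rows of a matrix are read as
elements of `L`, and the codewords are the matrices with `∑ θ_r * row_r = 0` for linearly
independent `θ_r`. A matrix of rank one with rows `l_r * x` violates this equation since
`(∑ l_r θ_r) * x ≠ 0`; the first row alone makes the map onto `L` surjective. -/
lemma exists_isFDMRD [Finite F] (S : Finset (Fin (k + 1) × Fin n))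
    (htop : ∀ r c, (r, c) ∈ S → ((0 : Fin (k + 1)), c) ∈ S)
    (hS : k + 1 ≤ (S.filter fun p => p.1 = 0).card) :
    ∃ C : Submodule F (Matrix (Fin (k + 1)) (Fin n) F), IsFDMRD S 2 C := by
  classical
  set N := (S.filter fun p => p.1 = 0).card with hN
  obtain ⟨L, _, _, hfin, hrank⟩ := exists_field_extension F N (by omega)
  let T : Finset (Fin n) := (S.filter fun p => p.1 = 0).image Prod.snd
  have hT : ∀ c, c ∈ T ↔ ((0 : Fin (k + 1)), c) ∈ S := by
    intro c
    simp [T]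
  have hTcard : T.card = N := by
    rw [hN]
    apply Finset.card_image_of_injOn
    rintro ⟨r, c⟩ h ⟨r', c'⟩ h' (he : c = c')
    simp only [Finset.coe_filter, Set.mem_ofPred_eq] at h h'
    rw [h.2, h'.2, he]
  -- the columns of the diagram index a basis of `L`
  have hcard : Fintype.card (Fin (finrank F L)) = Fintype.card T := by
    rw [Fintype.card_fin, Fintype.card_coe, hTcard, hrank]
  let b : Basis T F L := (finBasis F L).reindex (Fintype.equivOfCardEq hcard)
  let b' : Fin n → L := fun c => if h : c ∈ T then b ⟨c, h⟩ else 0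
  have hb' : ∀ c : T, b' c = b c := fun c => by simp [b']
  have hle : k + 1 ≤ finrank F L := by omega
  let θ : Fin (k + 1) → L := fun r => finBasis F L (Fin.castLE hle r)
  have hθ : LinearIndependent F θ :=
    (finBasis F L).linearIndependent.comp _ (Fin.castLE_injective hle)
  let Φ : (S → F) →ₗ[F] L :=
    Fintype.linearCombination F fun p : S => θ p.1.1 * b' p.1.2
  have hΦ : ∀ f, Φ f = ∑ r, θ r * ∑ c, matrixOfDiagram F S f r c • b' c := by
    intro f
    have h1 : Φ f = ∑ p : S, matrixOfDiagram F S f p.1.1 p.1.2 • (θ p.1.1 * b' p.1.2) := by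
      simp only [Φ, Fintype.linearCombination_apply, matrixOfDiagram_apply_mem]
    rw [h1, Finset.sum_coe_sort S
      (fun p => matrixOfDiagram F S f p.1 p.2 • (θ p.1 * b' p.2))]
    rw [Finset.sum_subset (Finset.subset_univ S), Fintype.sum_prod_type]
    · simp only [Finset.mul_sum, mul_smul_comm]
    · rintro ⟨r, c⟩ _ h
      simp only
      rw [matrixOfDiagram_apply_notMem S f h, zero_smul]
  have hsurj : Function.Surjective Φ := by
    intro y
    have hθ0 : θ 0 ≠ 0 := hθ.ne_zero 0
    refine ⟨fun p => if p.1.1 = 0 then (if h : p.1.2 ∈ T then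
      b.repr ((θ 0)⁻¹ * y) ⟨p.1.2, h⟩ else 0) else 0, ?_⟩
    rw [hΦ, Finset.sum_eq_single 0]
    · have : ∀ c : Fin n, matrixOfDiagram F S (fun p => if p.1.1 = 0 then
          (if h : p.1.2 ∈ T then b.repr ((θ 0)⁻¹ * y) ⟨p.1.2, h⟩ else 0) else 0) 0 c • b' c =
          if h : c ∈ T then b.repr ((θ 0)⁻¹ * y) ⟨c, h⟩ • b ⟨c, h⟩ else 0 := by
        intro c
        by_cases h : c ∈ T
        · have h' := (hT c).1 h
          simp [matrixOfDiagram, h, h', b']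
        · simp [b', h]
      simp only [this]
      rw [← Finset.sum_subset (Finset.subset_univ T) (fun c _ h => by simp [h]),
        ← Finset.sum_coe_sort T]
      have h2 := b.sum_repr ((θ 0)⁻¹ * y)
      simp only [Subtype.coe_eta, Finset.coe_mem, dite_true]
      rw [h2, mul_inv_cancel_left₀ hθ0]
    · intro r _ hr
      have : ∀ c : Fin n, matrixOfDiagram F S (fun p => if p.1.1 = 0 then
          (if h : p.1.2 ∈ T then b.repr ((θ 0)⁻¹ * y) ⟨p.1.2, h⟩ else 0) else 0) r c = 0 := by
        intro c
        simp [matrixOfDiagram, hr]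
      simp [this]
    · simp
  have hinj : Function.Injective (matrixOfDiagram F S) := by
    intro f g h
    funext p
    rw [← matrixOfDiagram_apply_mem S f, h, matrixOfDiagram_apply_mem]
  refine ⟨(LinearMap.ker Φ).map (matrixOfDiagram F S), ?_, ?_, ?_⟩
  · rintro _ ⟨f, _, rfl⟩ r c h
    exact matrixOfDiagram_apply_notMem S f h
  · rintro _ ⟨f, hf, rfl⟩ _ ⟨g, hg, rfl⟩ hne
    by_contra hlt
    rw [not_le, ← map_sub] at hlt
    have hfg : Φ (f - g) = 0 := by
      rw [map_sub, LinearMap.mem_ker.1 hf, LinearMap.mem_ker.1 hg, sub_zero]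
    have hne' : matrixOfDiagram F S (f - g) ≠ 0 := by
      rw [map_sub]; exact sub_ne_zero.2 hne
    obtain ⟨l, x, hlx⟩ := exists_eq_mul_of_rank_lt_two hlt
    rw [hΦ] at hfg
    have hprod : (∑ r, l r • θ r) * (∑ c, x c • b' c) = 0 := by
      rw [← hfg, Finset.sum_mul]
      refine Finset.sum_congr rfl fun r _ => ?_
      simp only [hlx, mul_smul, ← Finset.smul_sum]
      rw [smul_mul_assoc, mul_smul_comm]
    apply hne'
    rcases mul_eq_zero.1 hprod with h | h
    · have h0 := Fintype.linearIndependent_iff.1 hθ l h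
      ext r c
      rw [hlx, h0, zero_mul]; rfl
    · have hxT : ∀ c ∈ T, x c = 0 := by
        rw [← Finset.sum_subset (Finset.subset_univ T) (fun c _ h => by simp [b', h]),
          ← Finset.sum_coe_sort T] at h
        simp only [hb'] at h
        exact fun c hc => Fintype.linearIndependent_iff.1 b.linearIndependent
          (fun c => x c) h ⟨c, hc⟩
      ext r c
      by_cases hc : c ∈ T
      · rw [hlx, hxT c hc, mul_zero]; rfl
      · exact matrixOfDiagram_apply_notMem S _ fun h => hc ((hT c).2 (htop r c h))
  · rw [isLeast_dotsRemaining_iff hS,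
      ← (Submodule.equivMapOfInjective _ hinj (LinearMap.ker Φ)).finrank_eq]
    have h1 := LinearMap.finrank_range_add_finrank_ker Φ
    rw [LinearMap.range_eq_top.2 hsurj, finrank_top, Module.finrank_fintype_fun_eq_card,
      Fintype.card_coe, hrank] at h1
    have h2 := card_filter_first_row_add S
    omega

end Existence

/-! ### Counting dots of concatenated identifying vectors -/

section Concat

variable {n : ℕ}

/-- The position `c` of the prefix as a position of the whole vector. -/
def prefixPos (hn : 5 ≤ n) (c : Fin 5) : Fin n := ⟨c.val, by omega⟩

/-- The position `c` of the suffix as a position of the whole vector. -/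
def suffixPos (c : Fin (n - 5)) : Fin n := ⟨c.val + 5, by omega⟩

lemma concat_prefixPos (hn : 5 ≤ n) (u : Fin 5 → ZMod 2) (s : Fin (n - 5) → ZMod 2) (c : Fin 5) :
    concat n u s (prefixPos hn c) = u c := by
  simp [concat, prefixPos]

lemma concat_suffixPos (u : Fin 5 → ZMod 2) (s : Fin (n - 5) → ZMod 2) (c : Fin (n - 5)) :
    concat n u s (suffixPos c) = s c := by
  simp [concat, suffixPos]

lemma suffixPos_injective : Function.Injective (suffixPos (n := n)) := by
  intro c c' h
  simpa [suffixPos, Fin.ext_iff] using h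

lemma sum_eq_sum_prefix_add_sum_suffix (hn : 5 ≤ n) (f : Fin n → ℕ) :
    ∑ c, f c = ∑ c, f (prefixPos hn c) + ∑ c, f (suffixPos c) := by
  let e : Fin 5 ⊕ Fin (n - 5) ≃ Fin n := finSumFinEquiv.trans (finCongr (by omega))
  rw [← e.sum_comp, Fintype.sum_sum_type]
  congr 1
  refine Finset.sum_congr rfl fun c _ => congrArg f (Fin.ext ?_)
  simp [e, suffixPos, add_comm]

lemma card_filter_eq_prefix_add_suffix (hn : 5 ≤ n) (P : Fin n → Prop) [DecidablePred P] :
    (Finset.univ.filter P).card = (Finset.univ.filter fun c => P (prefixPos hn c)).card +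
      (Finset.univ.filter fun c => P (suffixPos c)).card := by
  simp only [Finset.card_filter]
  exact sum_eq_sum_prefix_add_sum_suffix hn _

lemma card_pivots_concat (hn : 5 ≤ n) (u : Fin 5 → ZMod 2) (s : Fin (n - 5) → ZMod 2) :
    (pivots (concat n u s)).card = (pivots u).card + (pivots s).card := by
  unfold pivots
  rw [card_filter_eq_prefix_add_suffix hn]
  simp only [concat_prefixPos, concat_suffixPos]

lemma card_pivots_concat_inter (hn : 5 ≤ n) (u u' : Fin 5 → ZMod 2)
    (s s' : Fin (n - 5) → ZMod 2) :
    (pivots (concat n u s) ∩ pivots (concat n u' s')).card =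
      (pivots u ∩ pivots u').card + (pivots s ∩ pivots s').card := by
  unfold pivots
  simp only [← Finset.filter_and]
  rw [card_filter_eq_prefix_add_suffix hn]
  simp only [concat_prefixPos, concat_suffixPos]

lemma onesBefore_concat_prefixPos (hn : 5 ≤ n) (u : Fin 5 → ZMod 2) (s : Fin (n - 5) → ZMod 2)
    (c : Fin 5) : onesBefore (concat n u s) (prefixPos hn c) = onesBefore u c := by
  unfold onesBefore
  rw [card_filter_eq_prefix_add_suffix hn]
  simp only [concat_prefixPos, concat_suffixPos]
  rw [Finset.filter_false_of_mem (s := (Finset.univ : Finset (Fin (n - 5)))), Finset.card_empty,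
    add_zero]
  · simp only [prefixPos, Fin.lt_def]
  · simp only [prefixPos, suffixPos, Fin.lt_def]
    omega

lemma onesBefore_concat_suffixPos (hn : 5 ≤ n) (u : Fin 5 → ZMod 2) (s : Fin (n - 5) → ZMod 2)
    (c : Fin (n - 5)) :
    onesBefore (concat n u s) (suffixPos c) = (pivots u).card + onesBefore s c := by
  unfold onesBefore pivots
  rw [card_filter_eq_prefix_add_suffix hn]
  simp only [concat_prefixPos, concat_suffixPos]
  congr 2
  · apply Finset.filter_congr
    intro x _
    simp only [prefixPos, suffixPos, Fin.lt_def]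
    constructor
    · exact fun h => h.2
    · exact fun h => ⟨by omega, h⟩
  · apply Finset.filter_congr
    intro x _
    simp only [suffixPos, Fin.lt_def, Nat.add_lt_add_iff_right]

/-- The number of dots outside the first row, counted column by column. -/
lemma dotsRemaining_ferrers_two_one (v : Fin n → ZMod 2) (hv : (pivots v).card = 5) :
    dotsRemaining (ferrers 5 v) 2 1 = ∑ c, if v c = 0 then onesBefore v c - 1 else 0 := by
  have hcol : ∀ o ≤ 5, (Finset.univ.filter fun r : Fin 5 => r.val < o ∧ 1 ≤ r.val).card
      = o - 1 := by
    intro o ho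
    interval_cases o <;> decide
  rw [dotsRemaining_two_one, ferrers, Finset.filter_filter, Finset.card_filter,
    Fintype.sum_prod_type_right]
  refine Finset.sum_congr rfl fun c _ => ?_
  simp only [and_assoc]
  rw [← Finset.card_filter]
  by_cases hc : v c = 0
  · simp only [hc, true_and, if_true]
    exact hcol _ (hv ▸ onesBefore_le_card v c)
  · simp [hc]

/-- The number of dots in the columns of the prefix `u`, without those in the first row. -/
def prefixDots (u : Fin 5 → ZMod 2) : ℕ :=
  ∑ c, if u c = 0 then onesBefore u c - 1 else 0

lemma dotsRemaining_ferrers_concat (hn : 5 ≤ n) (u : Fin 5 → ZMod 2) (s : Fin (n - 5) → ZMod 2)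
    (hv : (pivots u).card + (pivots s).card = 5) :
    dotsRemaining (ferrers 5 (concat n u s)) 2 1 =
      prefixDots u + ∑ c, if s c = 0 then (pivots u).card + onesBefore s c - 1 else 0 := by
  rw [dotsRemaining_ferrers_two_one _ (by rw [card_pivots_concat hn, hv]),
    sum_eq_sum_prefix_add_sum_suffix hn]
  simp only [concat_prefixPos, concat_suffixPos, onesBefore_concat_prefixPos,
    onesBefore_concat_suffixPos hn, prefixDots]

/-- All columns of zeros of the suffix have a dot in the first row. -/
lemma card_suffix_le_first_row (S : Finset (Fin 5 × Fin n)) (s : Fin (n - 5) → ZMod 2)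
    (hS : ∀ c, s c = 0 → ((0 : Fin 5), suffixPos c) ∈ S) :
    n - 5 ≤ (S.filter fun p => p.1 = 0).card + (pivots s).card := by
  have h1 : (Finset.univ.filter fun c => ¬ s c = 1).card ≤ (S.filter fun p => p.1 = 0).card := by
    apply Finset.card_le_card_of_injOn (fun c => ((0 : Fin 5), suffixPos c))
    · intro c hc
      have hc1 : s c ≠ 1 := by simpa using hc
      have hc0 : s c = 0 := by
        generalize s c = z at hc1
        revert hc1; revert z; decide
      simpa using hS c hc0
    · intro c _ c' _ h
      exact suffixPos_injective (Prod.mk.inj h).2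
  have h2 := Finset.card_filter_add_card_filter_not (s := (Finset.univ : Finset (Fin (n - 5))))
    (p := fun c => s c = 1)
  rw [Finset.card_univ, Fintype.card_fin] at h2
  unfold pivots
  omega

lemma suffix_mem_ferrers (hn : 5 ≤ n) {u : Fin 5 → ZMod 2} (hu : (pivots u).card ≠ 0)
    (s : Fin (n - 5) → ZMod 2) {c : Fin (n - 5)} (hc : s c = 0) :
    ((0 : Fin 5), suffixPos c) ∈ ferrers 5 (concat n u s) := by
  rw [mem_ferrers, concat_suffixPos, onesBefore_concat_suffixPos hn]
  refine ⟨hc, ?_⟩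
  simp only [Fin.val_zero]
  omega

/-- The zero at position `c` of the prefix `u` gives the leftmost dot of the first row, and this is
the only dot of its column. -/
def IsPendingPos (u : Fin 5 → ZMod 2) (c : Fin 5) : Prop :=
  u c = 0 ∧ onesBefore u c = 1 ∧ ∀ c' < c, u c' = 1 ∨ onesBefore u c' = 0

lemma pendingDot_concat (hn : 5 ≤ n) {u : Fin 5 → ZMod 2} {c : Fin 5} (hc : IsPendingPos u c)
    (s : Fin (n - 5) → ZMod 2) :
    pendingDot 5 (concat n u s) = {((0 : Fin 5), prefixPos hn c)} := by
  obtain ⟨h0, h1, hlt⟩ := hc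
  have hmem : ((0 : Fin 5), prefixPos hn c) ∈ ferrers 5 (concat n u s) := by
    rw [mem_ferrers, concat_prefixPos, onesBefore_concat_prefixPos, h1]
    exact ⟨h0, by simp⟩
  have hfirst : ∀ x : Fin n, ((0 : Fin 5), x) ∈ ferrers 5 (concat n u s) →
      prefixPos hn c ≤ x := by
    intro x hx
    by_contra hlx
    have hxc : x.val < c.val := by
      have := Fin.lt_def.1 (not_le.1 hlx)
      simpa [prefixPos] using this
    obtain ⟨y, rfl⟩ : ∃ y : Fin 5, x = prefixPos hn y := ⟨⟨x.val, by omega⟩, rfl⟩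
    rw [mem_ferrers, concat_prefixPos, onesBefore_concat_prefixPos] at hx
    rcases hlt y (Fin.lt_def.2 hxc) with h | h
    · rw [h] at hx
      exact absurd hx.1 (by decide)
    · rw [h] at hx
      exact absurd hx.2 (by simp)
  ext ⟨r, x⟩
  simp only [pendingDot, Finset.mem_filter, Finset.mem_singleton, Prod.mk.injEq]
  constructor
  · rintro ⟨hx, hr, hmin⟩
    have hr0 : r = 0 := Fin.ext (by simpa using hr)
    subst hr0
    exact ⟨rfl, le_antisymm (hmin _ hmem) (hfirst _ hx)⟩
  · rintro ⟨rfl, rfl⟩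
    exact ⟨hmem, by simp, fun x hx => hfirst x hx⟩

lemma dotsRemaining_sdiff_pendingDot {k : ℕ} (v : Fin n → ZMod 2) :
    dotsRemaining (ferrers k v \ pendingDot k v) 2 1 = dotsRemaining (ferrers k v) 2 1 := by
  rw [dotsRemaining_two_one, dotsRemaining_two_one]
  congr 1
  ext p
  simp only [Finset.mem_filter, Finset.mem_sdiff, pendingDot]
  constructor
  · rintro ⟨⟨h1, _⟩, h2⟩
    exact ⟨h1, h2⟩
  · rintro ⟨h1, h2⟩
    exact ⟨⟨h1, fun h => by omega⟩, h2⟩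

end Concat

section Edges

variable {m : ℕ}

lemma mem_pivots_edgeVector {a b : ℕ} {c : Fin m} :
    c ∈ pivots (edgeVector m a b) ↔ c.val + 1 = a ∨ c.val + 1 = b := by
  rw [mem_pivots, edgeVector]
  split_ifs with h
  · exact iff_of_true rfl h
  · exact iff_of_false zero_ne_one h

lemma card_filter_lt_edge {a x : ℕ} (ha : 1 ≤ a) (ham : a ≤ m) :
    (Finset.univ.filter fun c : Fin m => c.val < x ∧ c.val + 1 = a).card =
      if a ≤ x then 1 else 0 := by
  split_ifs with h
  · rw [Finset.card_eq_one]
    refine ⟨⟨a - 1, by omega⟩, ?_⟩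
    ext c
    simp only [Finset.mem_filter, Finset.mem_univ, true_and, Finset.mem_singleton, Fin.ext_iff]
    omega
  · rw [Finset.card_eq_zero]
    ext c
    simp only [Finset.mem_filter, Finset.mem_univ, true_and, Finset.notMem_empty, iff_false]
    omega

lemma onesBefore_edgeVector {a b : ℕ} (ha : 1 ≤ a) (hab : a < b) (hb : b ≤ m) (c : Fin m) :
    onesBefore (edgeVector m a b) c =
      (if a ≤ c.val then 1 else 0) + if b ≤ c.val then 1 else 0 := by
  rw [← card_filter_lt_edge (m := m) ha (by omega), ← card_filter_lt_edge (m := m) (by omega) hb,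
    ← Finset.card_union_of_disjoint]
  · unfold onesBefore
    congr 1
    ext x
    simp only [edgeVector, Finset.mem_filter, Finset.mem_univ, true_and, Finset.mem_union,
      Fin.lt_def]
    by_cases h : x.val + 1 = a ∨ x.val + 1 = b
    · simp only [h, if_true, and_true]
      omega
    · simp only [h, if_false, zero_ne_one, and_false, false_iff]
      omega
  · rw [Finset.disjoint_left]
    intro x
    simp only [Finset.mem_filter, Finset.mem_univ, true_and]
    omega

lemma card_pivots_edgeVector {a b : ℕ} (ha : 1 ≤ a) (hab : a < b) (hb : b ≤ m) :
    (pivots (edgeVector m a b)).card = 2 := by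
  rw [Finset.card_eq_two]
  refine ⟨⟨a - 1, by omega⟩, ⟨b - 1, by omega⟩, by simp only [ne_eq, Fin.ext_iff]; omega, ?_⟩
  ext c
  simp only [mem_pivots_edgeVector, Finset.mem_insert, Finset.mem_singleton, Fin.ext_iff]
  omega

/-- The number of dots outside the first row in the suffix columns, for a prefix of weight `3`,
depends only on the sum of the end points of the edge. -/
lemma sum_dots_edgeVector {a b : ℕ} (ha : 1 ≤ a) (hab : a < b) (hb : b ≤ m) :
    (∑ c, if edgeVector m a b c = 0 then 3 + onesBefore (edgeVector m a b) c - 1 else 0)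
      + (a + b) + 5 = 4 * m := by
  have hterm : ∀ c : Fin m,
      (if edgeVector m a b c = 0 then 3 + onesBefore (edgeVector m a b) c - 1 else 0)
        + ((if c.val < m ∧ c.val + 1 = a then 2 else 0)
          + (if c.val < m ∧ c.val + 1 = b then 3 else 0))
      = 2 + ((if a ≤ c.val then 1 else 0) + (if b ≤ c.val then 1 else 0)) := by
    intro c
    rw [onesBefore_edgeVector ha hab hb]
    unfold edgeVector
    by_cases h1 : c.val + 1 = a
    · have h2 : c.val + 1 ≠ b := by omega
      have h3 : ¬ a ≤ c.val := by omega
      have h4 : ¬ b ≤ c.val := by omega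
      simp [h1, h3, h4, show a ≠ b by omega]
    · by_cases h2 : c.val + 1 = b
      · have h3 : a ≤ c.val := by omega
        have h4 : ¬ b ≤ c.val := by omega
        simp [h2, h3, h4, show b ≠ a by omega]
      · simp only [h1, h2, or_self, if_false, and_false, if_true]
        omega
  have hsum := Finset.sum_congr (rfl : (Finset.univ : Finset (Fin m)) = _) fun c _ => hterm c
  have hcount : ∀ t ≤ m, (∑ c : Fin m, if t ≤ c.val then 1 else 0) = m - t := by
    intro t _
    rw [Fin.sum_univ_eq_sum_range (fun c => if t ≤ c then 1 else 0), ← Finset.card_filter,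
      ← Nat.card_Ico]
    congr 1
    ext x
    simp only [Finset.mem_filter, Finset.mem_range, Finset.mem_Ico]
    omega
  have hone : ∀ t w, 1 ≤ t → t ≤ m →
      (∑ c : Fin m, if c.val < m ∧ c.val + 1 = t then w else 0) = w := by
    intro t w h1 h2
    have := card_filter_lt_edge (m := m) (x := m) h1 h2
    rw [if_pos h2] at this
    rw [← Finset.sum_filter, Finset.sum_const, this, one_smul]
  simp only [Finset.sum_add_distrib, hcount a (by omega), hcount b hb,
    hone a 2 ha (by omega), hone b 3 (by omega) hb, Finset.sum_const, Finset.card_univ,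
    Fintype.card_fin, smul_eq_mul] at hsum
  omega

end Edges

/-! ### The classes of the circle (near) one-factorization -/

section MatchingClasses

/-- The edges `(a, b)`, `a < b`, of the class `P_j`. -/
def edges (m j : ℕ) : Finset (ℕ × ℕ) :=
  (Finset.Icc 1 m ×ˢ Finset.Icc 1 m).filter fun p => p.1 < p.2 ∧
    ((p.2 ≤ circleSize m ∧ p.1 + p.2 ≡ 2 * j [MOD circleSize m]) ∨
     (circleSize m < p.2 ∧ p.1 ≡ j [MOD circleSize m]))

lemma mem_edges {m j a b : ℕ} : (a, b) ∈ edges m j ↔ 1 ≤ a ∧ a < b ∧ b ≤ m ∧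
    ((b ≤ circleSize m ∧ a + b ≡ 2 * j [MOD circleSize m]) ∨
     (circleSize m < b ∧ a ≡ j [MOD circleSize m])) := by
  simp only [edges, Finset.mem_filter, Finset.mem_product, Finset.mem_Icc]
  constructor
  · rintro ⟨⟨⟨h1, _⟩, _, h2⟩, h3, h4⟩
    exact ⟨h1, h3, h2, h4⟩
  · rintro ⟨h1, h3, h2, h4⟩
    exact ⟨⟨⟨h1, by omega⟩, by omega, h2⟩, h3, h4⟩

lemma mem_matchingClass {m j : ℕ} {s : Fin m → ZMod 2} :
    s ∈ matchingClass m j ↔ ∃ p ∈ edges m j, s = edgeVector m p.1 p.2 := by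
  constructor
  · rintro ⟨a, b, h1, h2, h3, h4, h5⟩
    exact ⟨(a, b), mem_edges.2 ⟨h1, h2, h3, h5⟩, h4⟩
  · rintro ⟨⟨a, b⟩, h, h4⟩
    obtain ⟨h1, h2, h3, h5⟩ := mem_edges.1 h
    exact ⟨a, b, h1, h2, h3, h4, h5⟩

lemma circleSize_cases (m : ℕ) (hm : 1 ≤ m) :
    ∃ h, (m = 2 * h + 1 ∧ circleSize m = m) ∨ (m = 2 * h ∧ circleSize m + 1 = m) := by
  rcases Nat.even_or_odd m with hev | hodd
  · obtain ⟨h, hh⟩ := hev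
    refine ⟨h, Or.inr ⟨by omega, ?_⟩⟩
    rw [circleSize, if_pos ⟨h, hh⟩]
    omega
  · obtain ⟨h, hh⟩ := hodd
    refine ⟨h, Or.inl ⟨hh, ?_⟩⟩
    rw [circleSize, if_neg (Nat.not_even_iff_odd.2 ⟨h, hh⟩)]

lemma eq_of_modEq_of_lt_add {N x y : ℕ} (h : x ≡ y [MOD N]) (h1 : x < y + N) (h2 : y < x + N) :
    x = y := by
  obtain ⟨t, ht⟩ := (Nat.modEq_iff_dvd.1 h)
  rcases lt_trichotomy t 0 with h0 | h0 | h0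
  · nlinarith
  · subst h0; omega
  · nlinarith

/-- The edges of a class form a matching. -/
lemma eq_of_mem_edges_of_common {m j a b a' b' : ℕ} (hp : (a, b) ∈ edges m j)
    (hp' : (a', b') ∈ edges m j) (h : a = a' ∨ a = b' ∨ b = a' ∨ b = b') : a = a' ∧ b = b' := by
  obtain ⟨h1, h2, h3, h4⟩ := mem_edges.1 hp
  obtain ⟨h1', h2', h3', h4'⟩ := mem_edges.1 hp'
  obtain ⟨t, ht⟩ := circleSize_cases m (by omega)
  rcases h4 with ⟨hb, h4⟩ | ⟨hb, h4⟩ <;> rcases h4' with ⟨hb', h4'⟩ | ⟨hb', h4'⟩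
  · have hs := h4.trans h4'.symm
    rcases h with rfl | rfl | rfl | rfl
    · exact ⟨rfl, eq_of_modEq_of_lt_add (Nat.ModEq.add_left_cancel' _ hs) (by omega) (by omega)⟩
    · rw [add_comm a' a] at hs
      have := eq_of_modEq_of_lt_add (Nat.ModEq.add_left_cancel' _ hs) (by omega) (by omega)
      omega
    · rw [add_comm a b] at hs
      have := eq_of_modEq_of_lt_add (Nat.ModEq.add_left_cancel' _ hs) (by omega) (by omega)
      omega
    · exact ⟨eq_of_modEq_of_lt_add (Nat.ModEq.add_right_cancel' _ hs) (by omega) (by omega), rfl⟩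
  · -- `(a', b')` is the edge to the centre, whose end point has no partner on the circle
    have hs : a + b ≡ a' + a' [MOD circleSize m] := by
      have := h4'.add h4'
      rw [← two_mul j] at this
      exact h4.trans this.symm
    rcases h with rfl | rfl | rfl | rfl
    · have := eq_of_modEq_of_lt_add (Nat.ModEq.add_left_cancel' _ hs) (by omega) (by omega)
      omega
    · omega
    · have := eq_of_modEq_of_lt_add (Nat.ModEq.add_right_cancel' _ hs) (by omega) (by omega)
      omega
    · omega
  · have hs : a' + b' ≡ a + a [MOD circleSize m] := by
      have := h4.add h4
      rw [← two_mul j] at this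
      exact h4'.trans this.symm
    rcases h with rfl | rfl | rfl | rfl
    · have := eq_of_modEq_of_lt_add (Nat.ModEq.add_left_cancel' _ hs) (by omega) (by omega)
      omega
    · have := eq_of_modEq_of_lt_add (Nat.ModEq.add_right_cancel' _ hs) (by omega) (by omega)
      omega
    · omega
    · omega
  · have := eq_of_modEq_of_lt_add (h4.trans h4'.symm) (by omega) (by omega)
    omega

/-- Classes with different indices in `{2, …, m}` are disjoint; this range covers the number of
classes without repetition modulo the (odd) number of nodes on the circle. -/
lemma index_eq_of_mem_edges {m j j' a b : ℕ} (hj : 2 ≤ j) (hjm : j ≤ m) (hj' : 2 ≤ j')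
    (hjm' : j' ≤ m) (hp : (a, b) ∈ edges m j) (hp' : (a, b) ∈ edges m j') : j = j' := by
  obtain ⟨h1, h2, h3, h4⟩ := mem_edges.1 hp
  obtain ⟨-, -, -, h4'⟩ := mem_edges.1 hp'
  obtain ⟨t, ht⟩ := circleSize_cases m (by omega)
  have hmod : j ≡ j' [MOD circleSize m] := by
    rcases h4 with ⟨hb, h4⟩ | ⟨hb, h4⟩ <;> rcases h4' with ⟨hb', h4'⟩ | ⟨hb', h4'⟩
    · refine Nat.ModEq.cancel_left_of_coprime (c := 2) ?_ (h4.symm.trans h4')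
      have hodd : Odd (circleSize m) := by
        rcases ht with ht | ht
        · exact ⟨t, by omega⟩
        · exact ⟨t - 1, by omega⟩
      exact hodd.coprime_two_right
    · omega
    · omega
    · exact h4.symm.trans h4'
  exact eq_of_modEq_of_lt_add hmod (by omega) (by omega)

lemma card_pivots_of_mem_edges {m j a b : ℕ} (hp : (a, b) ∈ edges m j) :
    (pivots (edgeVector m a b)).card = 2 := by
  obtain ⟨h1, h2, h3, -⟩ := mem_edges.1 hp
  exact card_pivots_edgeVector h1 h2 h3

lemma card_inter_pivots_of_ne {m a b a' b' : ℕ} (hab : a < b) (hab' : a' < b')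
    (h : (a, b) ≠ (a', b')) :
    (pivots (edgeVector m a b) ∩ pivots (edgeVector m a' b')).card ≤ 1 := by
  rw [Finset.card_le_one]
  intro x hx y hy
  simp only [Finset.mem_inter, mem_pivots_edgeVector] at hx hy
  rw [ne_eq, Prod.mk.injEq] at h
  rw [Fin.ext_iff]
  omega

lemma card_inter_pivots_of_mem_edges {m j a b a' b' : ℕ} (hp : (a, b) ∈ edges m j)
    (hp' : (a', b') ∈ edges m j) (h : (a, b) ≠ (a', b')) :
    (pivots (edgeVector m a b) ∩ pivots (edgeVector m a' b')).card = 0 := by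
  rw [Finset.card_eq_zero, Finset.eq_empty_iff_forall_notMem]
  intro x hx
  simp only [Finset.mem_inter, mem_pivots_edgeVector] at hx
  obtain ⟨h1, h2⟩ := eq_of_mem_edges_of_common hp hp' (by omega)
  exact h (by rw [h1, h2])

/-- The number of chords with sum of end points `t`. -/
lemma card_filter_add_eq (N t : ℕ) :
    ((Finset.Icc 1 N ×ˢ Finset.Icc 1 N).filter fun p => p.1 < p.2 ∧ p.1 + p.2 = t).card =
      (t - 1) / 2 + 1 - max 1 (t - N) := by
  rw [← Nat.card_Icc]
  symm
  apply Finset.card_bij (fun a _ => (a, t - a))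
  · intro a ha
    simp only [Finset.mem_Icc, Finset.mem_filter, Finset.mem_product] at ha ⊢
    omega
  · intro a _ a' _ h
    exact (Prod.mk.inj h).1
  · rintro ⟨a, b⟩ h
    simp only [Finset.mem_Icc, Finset.mem_filter, Finset.mem_product] at h
    refine ⟨a, ?_, ?_⟩
    · simp only [Finset.mem_Icc]
      omega
    · rw [Prod.mk.injEq]
      omega

/-- Summation over the chords of a class: the sum of the end points takes at most two values. -/
lemma sum_chords {N j σ : ℕ} (hσ : 3 ≤ σ) (hσN : σ ≤ N + 2) (hj : σ ≡ 2 * j [MOD N])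
    (f : ℕ → ℚ) :
    ∑ p ∈ (Finset.Icc 1 N ×ˢ Finset.Icc 1 N).filter
        (fun p => p.1 < p.2 ∧ p.1 + p.2 ≡ 2 * j [MOD N]), f (p.1 + p.2) =
      ((σ - 1) / 2 + 1 - max 1 (σ - N) : ℕ) * f σ +
        ((σ + N - 1) / 2 + 1 - max 1 (σ + N - N) : ℕ) * f (σ + N) := by
  have hsplit : (Finset.Icc 1 N ×ˢ Finset.Icc 1 N).filter
        (fun p => p.1 < p.2 ∧ p.1 + p.2 ≡ 2 * j [MOD N]) =
      ((Finset.Icc 1 N ×ˢ Finset.Icc 1 N).filter fun p => p.1 < p.2 ∧ p.1 + p.2 = σ) ∪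
      ((Finset.Icc 1 N ×ˢ Finset.Icc 1 N).filter fun p => p.1 < p.2 ∧ p.1 + p.2 = σ + N) := by
    ext ⟨a, b⟩
    simp only [Finset.mem_Icc, Finset.mem_filter, Finset.mem_product, Finset.mem_union]
    constructor
    · rintro ⟨h1, h2, h3⟩
      have h4 := h3.trans hj.symm
      by_cases hlt : a + b < σ + N
      · exact Or.inl ⟨h1, h2, eq_of_modEq_of_lt_add h4 hlt (by
          by_contra hge
          -- here `a + b + N ≤ σ ≤ N + 2`, but `a + b ≥ 3`
          omega)⟩
      · refine Or.inr ⟨h1, h2, eq_of_modEq_of_lt_add (h4.trans ?_) (by omega) (by omega)⟩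
        simp [Nat.ModEq]
    · rintro (⟨h1, h2, h3⟩ | ⟨h1, h2, h3⟩)
      · exact ⟨h1, h2, h3 ▸ hj⟩
      · refine ⟨h1, h2, h3 ▸ Nat.ModEq.trans ?_ hj⟩
        simp [Nat.ModEq]
  rw [hsplit, Finset.sum_union]
  · rw [← card_filter_add_eq, ← card_filter_add_eq, ← nsmul_eq_mul, ← nsmul_eq_mul,
      ← Finset.sum_const, ← Finset.sum_const]
    congr 1 <;>
    · refine Finset.sum_congr rfl fun p hp => ?_
      rw [(Finset.mem_filter.1 hp).2.2]
  · rw [Finset.disjoint_left]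
    rintro p h1 h2
    have h1 := (Finset.mem_filter.1 h1).2.2
    have h2 := (Finset.mem_filter.1 h2).2.2
    have h3 : 1 ≤ N := by
      by_contra h0
      have : N = 0 := by omega
      subst this
      simp_all
    omega

lemma sum_edges_odd {m j σ : ℕ} (hm : Odd m) (hσ : 3 ≤ σ) (hσN : σ ≤ m + 2)
    (hj : σ ≡ 2 * j [MOD m]) (f : ℕ → ℚ) :
    ∑ p ∈ edges m j, f (p.1 + p.2) =
      ((σ - 1) / 2 + 1 - max 1 (σ - m) : ℕ) * f σ +
        ((σ + m - 1) / 2 + 1 - max 1 (σ + m - m) : ℕ) * f (σ + m) := by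
  rw [← sum_chords hσ hσN hj f]
  apply Finset.sum_congr _ fun _ _ => rfl
  have hN : circleSize m = m := by rw [circleSize, if_neg (Nat.not_even_iff_odd.2 hm)]
  ext ⟨a, b⟩
  simp only [edges, hN, Finset.mem_Icc, Finset.mem_filter, Finset.mem_product]
  constructor
  · rintro ⟨h1, h2, h3 | h3⟩
    · exact ⟨h1, h2, h3.2⟩
    · omega
  · rintro ⟨h1, h2, h3⟩
    exact ⟨h1, h2, Or.inl ⟨by omega, h3⟩⟩

lemma sum_edges_even {N j σ e : ℕ} (hm : Even (N + 1)) (hσ : 3 ≤ σ) (hσN : σ ≤ N + 2)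
    (hj : σ ≡ 2 * j [MOD N]) (he : 1 ≤ e) (heN : e ≤ N) (hej : e ≡ j [MOD N]) (f : ℕ → ℚ) :
    ∑ p ∈ edges (N + 1) j, f (p.1 + p.2) =
      ((σ - 1) / 2 + 1 - max 1 (σ - N) : ℕ) * f σ +
        ((σ + N - 1) / 2 + 1 - max 1 (σ + N - N) : ℕ) * f (σ + N) + f (e + (N + 1)) := by
  rw [← sum_chords hσ hσN hj f]
  have hN : circleSize (N + 1) = N := by rw [circleSize, if_pos hm]; rfl
  have hsplit : edges (N + 1) j = insert (e, N + 1) ((Finset.Icc 1 N ×ˢ Finset.Icc 1 N).filter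
        (fun p => p.1 < p.2 ∧ p.1 + p.2 ≡ 2 * j [MOD N])) := by
    ext ⟨a, b⟩
    simp only [edges, hN, Finset.mem_Icc, Finset.mem_filter, Finset.mem_product,
      Finset.mem_insert, Prod.mk.injEq]
    constructor
    · rintro ⟨h1, h2, ⟨h3, h4⟩ | ⟨h3, h4⟩⟩
      · exact Or.inr ⟨by omega, h2, h4⟩
      · exact Or.inl ⟨eq_of_modEq_of_lt_add (h4.trans hej.symm) (by omega) (by omega), by omega⟩
    · rintro (⟨rfl, rfl⟩ | ⟨h1, h2, h3⟩)
      · exact ⟨by omega, by omega, Or.inr ⟨by omega, hej⟩⟩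
      · exact ⟨by omega, h2, Or.inl ⟨by omega, h3⟩⟩
  rw [hsplit, Finset.sum_insert, add_comm]
  simp only [Finset.mem_Icc, Finset.mem_filter, Finset.mem_product]
  omega

lemma modEq_of_eq_add {N x y : ℕ} (h : y = x + N) : x ≡ y [MOD N] := by
  subst h
  simp [Nat.ModEq]

lemma sum_edges_ceilHalf_add_odd {h i : ℕ} (hi : 1 ≤ i) (hih : i ≤ h) (f : ℕ → ℚ) :
    ∑ p ∈ edges (2 * h + 1) (h + 1 + i), f (p.1 + p.2) =
      i * f (2 * i + 1) + (h - i) * f (2 * i + 2 * h + 2) := by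
  rw [sum_edges_odd ⟨h, rfl⟩ (σ := 2 * i + 1) (by omega) (by omega) (modEq_of_eq_add (by ring)),
    show (2 * i + 1 - 1) / 2 + 1 - max 1 (2 * i + 1 - (2 * h + 1)) = i by omega,
    show (2 * i + 1 + (2 * h + 1) - 1) / 2 + 1 - max 1 (2 * i + 1 + (2 * h + 1) - (2 * h + 1))
      = h - i by omega, Nat.cast_sub hih,
    show 2 * i + 1 + (2 * h + 1) = 2 * i + 2 * h + 2 by ring]

lemma sum_edges_succ_odd {h i : ℕ} (hi : 1 ≤ i) (hih : i ≤ h) (f : ℕ → ℚ) :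
    ∑ p ∈ edges (2 * h + 1) (i + 1), f (p.1 + p.2) =
      i * f (2 * i + 2) + (h - i) * f (2 * i + 2 * h + 3) := by
  rw [sum_edges_odd ⟨h, rfl⟩ (σ := 2 * i + 2) (by omega) (by omega)
      (by rw [show 2 * i + 2 = 2 * (i + 1) by ring]),
    show (2 * i + 2 - 1) / 2 + 1 - max 1 (2 * i + 2 - (2 * h + 1)) = i by omega,
    show (2 * i + 2 + (2 * h + 1) - 1) / 2 + 1 - max 1 (2 * i + 2 + (2 * h + 1) - (2 * h + 1))
      = h - i by omega, Nat.cast_sub hih,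
    show 2 * i + 2 + (2 * h + 1) = 2 * i + 2 * h + 3 by ring]

lemma sum_edges_ceilHalf_add_even {h i : ℕ} (hi : 1 ≤ i) (hih : i ≤ h) (f : ℕ → ℚ) :
    ∑ p ∈ edges (2 * h) (h + i), f (p.1 + p.2) =
      i * f (2 * i + 1) + (h - 1 - i) * f (2 * i + 2 * h) + f (3 * h + i) := by
  obtain ⟨N, hN⟩ : ∃ N, 2 * h = N + 1 := ⟨2 * h - 1, by omega⟩
  rcases hih.eq_or_lt with rfl | hlt
  · -- the edge to the centre is `(1, 2 h)`, with the same sum as the other edges of the class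
    rw [hN, sum_edges_even (e := 1) (σ := N + 2) (hN ▸ even_two_mul i) (by omega) (by omega)
      (modEq_of_eq_add (by omega)) le_rfl (by omega) (modEq_of_eq_add (by omega)),
      show (N + 2 - 1) / 2 + 1 - max 1 (N + 2 - N) = i - 1 by omega,
      show (N + 2 + N - 1) / 2 + 1 - max 1 (N + 2 + N - N) = 0 by omega,
      show 1 + (N + 1) = N + 2 by ring, show 3 * i + i = N + 1 + (N + 1) by omega,
      show N + 1 + 1 = N + 2 by ring, Nat.cast_sub hi]
    push_cast
    ring
  · rw [hN, sum_edges_even (e := h + i) (σ := 2 * i + 1) (hN ▸ even_two_mul h) (by omega)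
      (by omega) (modEq_of_eq_add (by omega)) (by omega) (by omega) rfl,
      show (2 * i + 1 - 1) / 2 + 1 - max 1 (2 * i + 1 - N) = i by omega,
      show (2 * i + 1 + N - 1) / 2 + 1 - max 1 (2 * i + 1 + N - N) = h - (1 + i) by omega,
      show h + i + (N + 1) = 3 * h + i by omega, show 2 * i + 1 + N = 2 * i + (N + 1) by ring,
      Nat.cast_sub (by omega)]
    push_cast
    ring

lemma sum_edges_succ_even {h i : ℕ} (hi : 1 ≤ i) (hih : i < h) (f : ℕ → ℚ) :
    ∑ p ∈ edges (2 * h) (i + 1), f (p.1 + p.2) =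
      i * f (2 * i + 2) + (h - 1 - i) * f (2 * i + 2 * h + 1) + f (2 * h + i + 1) := by
  obtain ⟨N, hN⟩ : ∃ N, 2 * h = N + 1 := ⟨2 * h - 1, by omega⟩
  rw [hN, sum_edges_even (e := i + 1) (σ := 2 * i + 2) (hN ▸ even_two_mul h) (by omega)
    (by omega) (by rw [show 2 * i + 2 = 2 * (i + 1) by ring]) (by omega) (by omega) rfl,
    show (2 * i + 2 - 1) / 2 + 1 - max 1 (2 * i + 2 - N) = i by omega,
    show (2 * i + 2 + N - 1) / 2 + 1 - max 1 (2 * i + 2 + N - N) = h - (1 + i) by omega,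
    show i + 1 + (N + 1) = N + 1 + i + 1 by ring,
    show 2 * i + 2 + N = 2 * i + (N + 1) + 1 by ring, Nat.cast_sub (by omega)]
  push_cast
  ring

end MatchingClasses

/-! ### The identifying vectors of the construction -/

section Index

/-- The two prefixes of `𝒜_(g+1)`. -/
def prefixes : Fin 5 → Fin 2 → Fin 5 → ZMod 2 :=
  ![![![1, 1, 1, 0, 0], ![1, 0, 0, 1, 1]],
    ![![1, 1, 0, 1, 0], ![0, 1, 1, 0, 1]],
    ![![0, 1, 1, 1, 0], ![1, 0, 1, 0, 1]],
    ![![0, 0, 1, 1, 1], ![1, 1, 0, 0, 1]],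
    ![![1, 0, 1, 1, 0], ![0, 1, 0, 1, 1]]]

/-- The indices of the classes that serve as suffixes in `𝒜_(g+1)`. -/
def classes (q n : ℕ) : Fin 5 → Finset ℕ :=
  ![{ceilHalf (n - 5) + 1}, {2}, {ceilHalf (n - 5) + 2}, {3},
    (Finset.Icc 3 (min (ceilHalf q + 2) (floorHalf (n - 5)))).image (ceilHalf (n - 5) + ·) ∪
      Finset.Icc 4 (min (floorHalf q + 3) (ceilHalf (n - 5)))]

/-- The position of the first pivot in the prefixes of `𝒜₅`. -/
def firstPivotPos : Fin 2 → Fin 5 := ![0, 1]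

/-- The position of the pending dot in the prefixes of `𝒜₅`. -/
def pendingPos : Fin 2 → Fin 5 := ![1, 2]

/-- A prefix, the index of a class, and an edge. -/
abbrev Index : Type := Σ _ : Fin 5 × Fin 2, Σ _ : ℕ, ℕ × ℕ

/-- The prefix of the identifying vector with the given index. -/
def Index.pre (i : Index) : Fin 5 → ZMod 2 := prefixes i.1.1 i.1.2

/-- The suffix of the identifying vector with the given index. -/
def Index.suf (n : ℕ) (i : Index) : Fin (n - 5) → ZMod 2 :=
  edgeVector (n - 5) i.2.2.1 i.2.2.2

/-- The identifying vector with the given index. -/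
def Index.vec (n : ℕ) (i : Index) : Fin n → ZMod 2 := concat n i.pre (i.suf n)

/-- The indices of the identifying vectors in `𝒜₁ ∪ … ∪ 𝒜₅`. -/
def indices (q n : ℕ) : Finset Index :=
  Finset.univ.sigma fun k => (classes q n k.1).sigma fun j => edges (n - 5) j

lemma mem_indices {q n : ℕ} {i : Index} :
    i ∈ indices q n ↔ i.2.1 ∈ classes q n i.1.1 ∧ i.2.2 ∈ edges (n - 5) i.2.1 := by
  simp [indices]

lemma card_pivots_prefixes (g : Fin 5) (e : Fin 2) : (pivots (prefixes g e)).card = 3 := by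
  revert g e; decide

lemma card_inter_pivots_prefixes {g g' : Fin 5} {e e' : Fin 2} (h : (g, e) ≠ (g', e')) :
    (pivots (prefixes g e) ∩ pivots (prefixes g' e')).card ≤ 2 := by
  revert g e g' e'; decide

lemma card_inter_pivots_prefixes_of_pair {g : Fin 5} {e e' : Fin 2} (h : e ≠ e') :
    (pivots (prefixes g e) ∩ pivots (prefixes g e')).card ≤ 1 := by
  revert g e e'; decide

lemma isPendingPos_pendingPos (e : Fin 2) : IsPendingPos (prefixes 4 e) (pendingPos e) := by
  revert e; unfold IsPendingPos; decide

lemma firstPivotPos_spec (e : Fin 2) : prefixes 4 e (firstPivotPos e) = 1 ∧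
    onesBefore (prefixes 4 e) (firstPivotPos e) = 0 := by
  revert e; decide

lemma mem_prefixesA5 {u : Fin 5 → ZMod 2} : u ∈ prefixesA5 ↔ ∃ e, u = prefixes 4 e := by
  rw [Fin.exists_fin_two]; rfl

lemma mem_classes_four {q n j : ℕ} : j ∈ classes q n 4 ↔ j ∈ indicesA5 q n := by
  have h : classes q n 4 =
    (Finset.Icc 3 (min (ceilHalf q + 2) (floorHalf (n - 5)))).image (ceilHalf (n - 5) + ·) ∪
      Finset.Icc 4 (min (floorHalf q + 3) (ceilHalf (n - 5))) := rfl
  rw [h]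
  simp only [Finset.mem_union, Finset.mem_image, Finset.mem_Icc, indicesA5, Set.mem_union,
    Set.mem_ofPred_eq, and_assoc, eq_comm]

lemma eq_of_mem_classes {q n : ℕ} {g : Fin 5} (hg : g ≠ 4) {j j' : ℕ} (h : j ∈ classes q n g)
    (h' : j' ∈ classes q n g) : j = j' := by
  fin_cases g <;> simp_all [classes]

lemma bounds_of_mem_classes {q n : ℕ} (hn : 12 ≤ n) {g : Fin 5} {j : ℕ} (h : j ∈ classes q n g) :
    2 ≤ j ∧ j ≤ n - 5 := by
  fin_cases g <;>
    simp only [classes, ceilHalf, floorHalf, Fin.zero_eta, Fin.mk_one, Fin.reduceFinMk,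
      Matrix.cons_val, Finset.mem_singleton, Finset.mem_union, Finset.mem_image,
      Finset.mem_Icc] at h
  all_goals first | omega | (rcases h with ⟨i, h, rfl⟩ | h <;> omega)

lemma ne_of_mem_classes {q n : ℕ} (hn : 12 ≤ n) {g g' : Fin 5} (hg : g ≠ g') {j j' : ℕ}
    (h : j ∈ classes q n g) (h' : j' ∈ classes q n g') : j ≠ j' := by
  wlog hlt : g < g' generalizing g g' j j'
  · exact (this hg.symm h' h (lt_of_le_of_ne (not_lt.1 hlt) hg.symm)).symm
  fin_cases g <;> fin_cases g' <;> first | exact absurd hlt (by decide) | skip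
  all_goals
    simp only [classes, ceilHalf, floorHalf, Fin.zero_eta, Fin.mk_one, Fin.reduceFinMk,
      Matrix.cons_val, Finset.mem_singleton, Finset.mem_union, Finset.mem_image,
      Finset.mem_Icc] at h h'
  all_goals omega

lemma card_classes_four_le (q n : ℕ) : (classes q n 4).card ≤ q := by
  have h : classes q n 4 =
    (Finset.Icc 3 (min (ceilHalf q + 2) (floorHalf (n - 5)))).image (ceilHalf (n - 5) + ·) ∪
      Finset.Icc 4 (min (floorHalf q + 3) (ceilHalf (n - 5))) := rfl
  rw [h]
  refine (Finset.card_union_le _ _).trans ((Nat.add_le_add_right Finset.card_image_le _).trans ?_)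
  simp only [Nat.card_Icc, ceilHalf, floorHalf]
  omega

variable {n : ℕ}

lemma card_pivots_suf {q : ℕ} {i : Index} (hi : i ∈ indices q n) :
    (pivots (i.suf n)).card = 2 :=
  card_pivots_of_mem_edges (mem_indices.1 hi).2

lemma card_pivots_vec (hn : 12 ≤ n) {q : ℕ} {i : Index} (hi : i ∈ indices q n) :
    (pivots (i.vec n)).card = 5 := by
  rw [Index.vec, card_pivots_concat (by omega), card_pivots_suf hi, Index.pre,
    card_pivots_prefixes]

lemma mem_idVectors {U : Set (Fin 5 → ZMod 2)} {j : ℕ} {v : Fin n → ZMod 2} :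
    v ∈ idVectors n U j ↔ ∃ u ∈ U, ∃ p ∈ edges (n - 5) j,
      v = concat n u (edgeVector (n - 5) p.1 p.2) := by
  simp only [idVectors, Set.mem_ofPred_eq, mem_matchingClass]
  constructor
  · rintro ⟨u, hu, _, ⟨p, hp, rfl⟩, h⟩
    exact ⟨u, hu, p, hp, h⟩
  · rintro ⟨u, hu, p, hp, h⟩
    exact ⟨u, hu, _, ⟨p, hp, rfl⟩, h⟩

lemma mem_idA1_to_idA4 {q : ℕ} {v : Fin n → ZMod 2} :
    v ∈ idA1 n ∪ idA2 n ∪ idA3 n ∪ idA4 n ↔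
      ∃ i ∈ indices q n, i.1.1 ≠ 4 ∧ v = i.vec n := by
  simp only [Set.mem_union, idA1, idA2, idA3, idA4, mem_idVectors, Set.mem_insert_iff,
    Set.mem_singleton_iff, exists_eq_or_imp, exists_eq_left]
  constructor
  · rintro ((((⟨p, hp, rfl⟩ | ⟨p, hp, rfl⟩) | (⟨p, hp, rfl⟩ | ⟨p, hp, rfl⟩)) |
      (⟨p, hp, rfl⟩ | ⟨p, hp, rfl⟩)) | (⟨p, hp, rfl⟩ | ⟨p, hp, rfl⟩))
    · exact ⟨⟨(0, 0), _, p⟩, mem_indices.2 ⟨by simp [classes], hp⟩,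
        (by decide : (0 : Fin 5) ≠ 4), rfl⟩
    · exact ⟨⟨(0, 1), _, p⟩, mem_indices.2 ⟨by simp [classes], hp⟩,
        (by decide : (0 : Fin 5) ≠ 4), rfl⟩
    · exact ⟨⟨(1, 0), _, p⟩, mem_indices.2 ⟨by simp [classes], hp⟩,
        (by decide : (1 : Fin 5) ≠ 4), rfl⟩
    · exact ⟨⟨(1, 1), _, p⟩, mem_indices.2 ⟨by simp [classes], hp⟩,
        (by decide : (1 : Fin 5) ≠ 4), rfl⟩
    · exact ⟨⟨(2, 0), _, p⟩, mem_indices.2 ⟨by simp [classes], hp⟩,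
        (by decide : (2 : Fin 5) ≠ 4), rfl⟩
    · exact ⟨⟨(2, 1), _, p⟩, mem_indices.2 ⟨by simp [classes], hp⟩,
        (by decide : (2 : Fin 5) ≠ 4), rfl⟩
    · exact ⟨⟨(3, 0), _, p⟩, mem_indices.2 ⟨by simp [classes], hp⟩,
        (by decide : (3 : Fin 5) ≠ 4), rfl⟩
    · exact ⟨⟨(3, 1), _, p⟩, mem_indices.2 ⟨by simp [classes], hp⟩,
        (by decide : (3 : Fin 5) ≠ 4), rfl⟩
  · rintro ⟨⟨⟨g, e⟩, j, p⟩, hi, hg, rfl⟩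
    obtain ⟨hj, hp⟩ := mem_indices.1 hi
    simp only at hj hp hg
    fin_cases g
    · obtain rfl := Finset.mem_singleton.1 hj
      fin_cases e
      · exact Or.inl (Or.inl (Or.inl (Or.inl ⟨p, hp, rfl⟩)))
      · exact Or.inl (Or.inl (Or.inl (Or.inr ⟨p, hp, rfl⟩)))
    · obtain rfl := Finset.mem_singleton.1 hj
      fin_cases e
      · exact Or.inl (Or.inl (Or.inr (Or.inl ⟨p, hp, rfl⟩)))
      · exact Or.inl (Or.inl (Or.inr (Or.inr ⟨p, hp, rfl⟩)))
    · obtain rfl := Finset.mem_singleton.1 hj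
      fin_cases e
      · exact Or.inl (Or.inr (Or.inl ⟨p, hp, rfl⟩))
      · exact Or.inl (Or.inr (Or.inr ⟨p, hp, rfl⟩))
    · obtain rfl := Finset.mem_singleton.1 hj
      fin_cases e
      · exact Or.inr (Or.inl ⟨p, hp, rfl⟩)
      · exact Or.inr (Or.inr ⟨p, hp, rfl⟩)
    · exact absurd rfl hg

lemma mem_idA5 {q : ℕ} {v : Fin n → ZMod 2} :
    v ∈ idA5 q n ↔ ∃ i ∈ indices q n, i.1.1 = 4 ∧ v = i.vec n := by
  simp only [idA5, Set.mem_ofPred_eq, mem_idVectors, mem_prefixesA5, ← mem_classes_four]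
  constructor
  · rintro ⟨j, hj, _, ⟨e, rfl⟩, p, hp, rfl⟩
    exact ⟨⟨(4, e), j, p⟩, mem_indices.2 ⟨hj, hp⟩, rfl, rfl⟩
  · rintro ⟨⟨⟨g, e⟩, j, p⟩, hi, hg, rfl⟩
    obtain ⟨hj, hp⟩ := mem_indices.1 hi
    simp only at hj hp hg
    subst hg
    exact ⟨j, hj, _, ⟨e, rfl⟩, p, hp, rfl⟩

/-- The Ferrers diagram carrying the code for an index: for `𝒜₅` the pending dot is removed. -/
def Index.diagram (n : ℕ) (i : Index) : Finset (Fin 5 × Fin n) :=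
  if i.1.1 = 4 then ferrers 5 (i.vec n) \ pendingDot 5 (i.vec n) else ferrers 5 (i.vec n)

lemma diagram_subset (i : Index) : i.diagram n ⊆ ferrers 5 (i.vec n) := by
  unfold Index.diagram
  split_ifs
  · exact Finset.sdiff_subset
  · exact subset_rfl

lemma dotsRemaining_diagram (hn : 12 ≤ n) {q : ℕ} {i : Index} (hi : i ∈ indices q n) :
    dotsRemaining (i.diagram n) 2 1 + (i.2.2.1 + i.2.2.2) + 5 =
      4 * (n - 5) + prefixDots i.pre := by
  have h1 : dotsRemaining (i.diagram n) 2 1 = dotsRemaining (ferrers 5 (i.vec n)) 2 1 := by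
    unfold Index.diagram
    split_ifs
    · exact dotsRemaining_sdiff_pendingDot _
    · rfl
  obtain ⟨k, j, a, b⟩ := i
  obtain ⟨ha, hab, hb, -⟩ := mem_edges.1 (mem_indices.1 hi).2
  have h2 := sum_dots_edgeVector ha hab hb
  rw [h1, Index.vec, dotsRemaining_ferrers_concat (by omega), Index.pre, card_pivots_prefixes,
    Index.suf]
  · dsimp only
    omega
  · rw [card_pivots_suf hi, Index.pre, card_pivots_prefixes]

lemma five_le_card_first_row_diagram (hn : 12 ≤ n) {q : ℕ} {i : Index} (hi : i ∈ indices q n) :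
    4 + 1 ≤ ((i.diagram n).filter fun p => p.1 = 0).card := by
  have h := card_suffix_le_first_row (i.diagram n) (i.suf n) ?_
  · rw [card_pivots_suf hi] at h
    omega
  · intro c hc
    have hmem : ((0 : Fin 5), suffixPos c) ∈ ferrers 5 (i.vec n) :=
      suffix_mem_ferrers (by omega) (by rw [Index.pre, card_pivots_prefixes]; norm_num) _ hc
    unfold Index.diagram
    split_ifs with hg
    · obtain ⟨⟨g, e⟩, j, p⟩ := i
      simp only at hg
      subst hg
      refine Finset.mem_sdiff.2 ⟨hmem, ?_⟩
      rw [Index.vec, Index.pre, pendingDot_concat (by omega) (isPendingPos_pendingPos e)]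
      simp only [Finset.mem_singleton, Prod.mk.injEq, true_and, suffixPos, prefixPos,
        Fin.mk.injEq]
      omega
    · exact hmem

lemma diagram_top (hn : 12 ≤ n) (i : Index) (r : Fin 5) (c : Fin n) (h : (r, c) ∈ i.diagram n) :
    ((0 : Fin 5), c) ∈ i.diagram n := by
  have htop : ∀ r c, (r, c) ∈ ferrers 5 (i.vec n) →
      ((0 : Fin 5), c) ∈ ferrers 5 (i.vec n) := by
    intro r c h
    rw [mem_ferrers] at h ⊢
    exact ⟨h.1, by simp only [Fin.val_zero]; omega⟩
  unfold Index.diagram at h ⊢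
  split_ifs with hg
  · rw [if_pos hg] at h
    obtain ⟨h1, h2⟩ := Finset.mem_sdiff.1 h
    refine Finset.mem_sdiff.2 ⟨htop r c h1, fun h3 => h2 ?_⟩
    obtain ⟨⟨g, e⟩, j, p⟩ := i
    simp only at hg
    subst hg
    -- the pending dot is the only dot of its column
    rw [Index.vec, Index.pre, pendingDot_concat (by omega) (isPendingPos_pendingPos e),
      Finset.mem_singleton, Prod.mk.injEq] at h3 ⊢
    refine ⟨?_, h3.2⟩
    rw [mem_ferrers, h3.2, Index.vec, Index.pre, onesBefore_concat_prefixPos,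
      (isPendingPos_pendingPos e).2.1] at h1
    exact Fin.ext (by simpa using h1.2)
  · rw [if_neg hg] at h
    exact htop r c h

end Index

/-! ### The code as a union of blocks -/

section Blocks

variable {F : Type*} [Field F] {n : ℕ}

/-- The identifying vector `(11111 || 0…0)`. -/
def topVec (n : ℕ) : Fin n → ZMod 2 := concat n ![1, 1, 1, 1, 1] 0

/-- The Ferrers tableaux form of the codeword given by the matrix `A`: for `𝒜₅` the value
belonging to the prefix and the class is put on the pending dot. -/
def Index.fill (n : ℕ) (a : (Fin 5 → ZMod 2) → ℕ → F) (i : Index)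
    (A : Matrix (Fin 5) (Fin n) F) : Matrix (Fin 5) (Fin n) F :=
  if i.1.1 = 4 then withPending (i.vec n) (a i.pre i.2.1) A else A

/-- The codewords with the identifying vector of index `i`. -/
def Index.block (n : ℕ) (fd : (Fin n → ZMod 2) → Submodule F (Matrix (Fin 5) (Fin n) F))
    (a : (Fin 5 → ZMod 2) → ℕ → F) (i : Index) : Set (Submodule F (Fin n → F)) :=
  (fun A => lift (i.vec n) (i.fill n a A)) '' (fd (i.vec n) : Set (Matrix (Fin 5) (Fin n) F))

/-- The construction in terms of indices, with `𝒜₁, …, 𝒜₅` treated alike. -/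
lemma isConstructionC5_iff {D : Set (Submodule F (Fin (n - 5) → F))}
    {C : Set (Submodule F (Fin n → F))} :
    IsConstructionC5 n D C ↔
      ∃ (fd : (Fin n → ZMod 2) → Submodule F (Matrix (Fin 5) (Fin n) F))
        (a : (Fin 5 → ZMod 2) → ℕ → F),
        IsFDMRD (ferrers 5 (topVec n)) 2 (fd (topVec n)) ∧
        (∀ i ∈ indices (Nat.card F) n, IsFDMRD (i.diagram n) 2 (fd (i.vec n))) ∧
        (∀ e, Set.InjOn (a (prefixes 4 e)) (classes (Nat.card F) n 4)) ∧
        C = (lift (topVec n) '' (fd (topVec n) : Set (Matrix (Fin 5) (Fin n) F)) ∪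
          ⋃ i ∈ indices (Nat.card F) n, i.block n fd a) ∪
          (fun Y => Submodule.map (prependZeros F n) Y) '' D := by
  have hJ : (classes (Nat.card F) n 4 : Set ℕ) = indicesA5 (Nat.card F) n :=
    Set.ext fun j => mem_classes_four
  have hA : ∀ v : Fin n → ZMod 2, v ∈ idA0 n ∪ idA1 n ∪ idA2 n ∪ idA3 n ∪ idA4 n ↔
      v = topVec n ∨ ∃ i ∈ indices (Nat.card F) n, i.1.1 ≠ 4 ∧ v = i.vec n := by
    intro v
    rw [← mem_idA1_to_idA4]
    simp only [Set.mem_union, idA0, topVec, Set.mem_singleton_iff, or_assoc]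
  unfold IsConstructionC5
  refine exists_congr fun fd => exists_congr fun a => ?_
  have hcode : {X | ∃ v ∈ idA0 n ∪ idA1 n ∪ idA2 n ∪ idA3 n ∪ idA4 n, ∃ A ∈ fd v,
        X = lift v A} ∪
      {X | ∃ u ∈ prefixesA5, ∃ j ∈ indicesA5 (Nat.card F) n, ∃ s ∈ matchingClass (n - 5) j,
          ∃ A ∈ fd (concat n u s),
            X = lift (concat n u s) (withPending (concat n u s) (a u j) A)} ∪
      {X | ∃ Y ∈ D, X = Y.map (prependZeros F n)} =
      (lift (topVec n) '' (fd (topVec n) : Set (Matrix (Fin 5) (Fin n) F)) ∪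
        ⋃ i ∈ indices (Nat.card F) n, i.block n fd a) ∪
        (fun Y => Submodule.map (prependZeros F n) Y) '' D := by
    congr 1
    · ext X
      simp only [Set.mem_union, Set.mem_ofPred_eq, Set.mem_image, Set.mem_iUnion, exists_prop,
        SetLike.mem_coe]
      constructor
      · rintro (⟨v, hv, A, hAm, rfl⟩ | ⟨u, hu, j, hj, s, hs, A, hAm, rfl⟩)
        · rcases (hA v).1 hv with rfl | ⟨i, hi, hg, rfl⟩
          · exact Or.inl ⟨A, hAm, rfl⟩
          · exact Or.inr ⟨i, hi, A, hAm, by simp [Index.fill, hg]⟩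
        · obtain ⟨e, rfl⟩ := mem_prefixesA5.1 hu
          obtain ⟨p, hp, rfl⟩ := mem_matchingClass.1 hs
          refine Or.inr ⟨⟨(4, e), j, p⟩, mem_indices.2 ⟨mem_classes_four.2 hj, hp⟩, A, hAm, ?_⟩
          simp only [Index.fill, if_true]
          rfl
      · rintro (⟨A, hAm, rfl⟩ | ⟨i, hi, A, hAm, rfl⟩)
        · exact Or.inl ⟨_, (hA _).2 (Or.inl rfl), A, hAm, rfl⟩
        · by_cases hg : i.1.1 = 4
          · obtain ⟨⟨g, e⟩, j, p⟩ := i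
            simp only at hg
            subst hg
            obtain ⟨hj, hp⟩ := mem_indices.1 hi
            refine Or.inr ⟨_, mem_prefixesA5.2 ⟨e, rfl⟩, j, mem_classes_four.1 hj, _,
              mem_matchingClass.2 ⟨p, hp, rfl⟩, A, hAm, ?_⟩
            simp only [Index.fill, if_true]
            rfl
          · exact Or.inl ⟨_, (hA _).2 (Or.inr ⟨i, hi, hg, rfl⟩), A, hAm,
              by simp [Index.fill, hg]⟩
    · ext X
      simp only [Set.mem_ofPred_eq, Set.mem_image, eq_comm]
  rw [hcode, hJ]
  constructor
  · rintro ⟨h1, h2, h3, h4⟩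
    refine ⟨h1 _ ((hA _).2 (Or.inl rfl)), fun i hi => ?_,
      fun e => h3 _ (mem_prefixesA5.2 ⟨e, rfl⟩), h4⟩
    unfold Index.diagram
    split_ifs with hg
    · exact h2 _ (mem_idA5.2 ⟨i, hi, hg, rfl⟩)
    · exact h1 _ ((hA _).2 (Or.inr ⟨i, hi, hg, rfl⟩))
  · rintro ⟨h1, h2, h3, h4⟩
    refine ⟨fun v hv => ?_, fun v hv => ?_, fun u hu => ?_, h4⟩
    · rcases (hA v).1 hv with rfl | ⟨i, hi, hg, rfl⟩
      · exact h1
      · have := h2 i hi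
        rwa [Index.diagram, if_neg hg] at this
    · obtain ⟨i, hi, hg, rfl⟩ := mem_idA5.1 hv
      have := h2 i hi
      rwa [Index.diagram, if_pos hg] at this
    · obtain ⟨e, rfl⟩ := mem_prefixesA5.1 hu
      exact h3 e

lemma card_pivots_topVec (hn : 12 ≤ n) : (pivots (topVec n)).card = 5 := by
  rw [topVec, card_pivots_concat (by omega),
    show (pivots (![1, 1, 1, 1, 1] : Fin 5 → ZMod 2)).card = 5 by decide]
  simp [pivots]

lemma card_inter_pivots_topVec (hn : 12 ≤ n) (i : Index) :
    (pivots (topVec n) ∩ pivots (i.vec n)).card ≤ 3 := by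
  rw [topVec, Index.vec, card_pivots_concat_inter (by omega)]
  have h1 : (pivots (0 : Fin (n - 5) → ZMod 2)) = ∅ := by simp [pivots]
  rw [h1, Finset.empty_inter, Finset.card_empty, add_zero]
  exact (Finset.card_le_card Finset.inter_subset_right).trans (card_pivots_prefixes _ _).le

lemma dotsRemaining_ferrers_topVec (hn : 12 ≤ n) :
    dotsRemaining (ferrers 5 (topVec n)) 2 1 = 4 * (n - 5) := by
  have h5 : (pivots (![1, 1, 1, 1, 1] : Fin 5 → ZMod 2)).card = 5 := by decide
  have h0 : (pivots (0 : Fin (n - 5) → ZMod 2)).card = 0 := by simp [pivots]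
  have h1 : ∀ c, onesBefore (0 : Fin (n - 5) → ZMod 2) c = 0 := fun c => by simp [onesBefore]
  have h2 : prefixDots ![1, 1, 1, 1, 1] = 0 := by decide
  rw [topVec, dotsRemaining_ferrers_concat (by omega) _ _ (by rw [h5, h0]), h5, h2]
  simp [h1, mul_comm]

lemma five_le_card_first_row_topVec (hn : 12 ≤ n) :
    4 + 1 ≤ ((ferrers 5 (topVec n)).filter fun p => p.1 = 0).card := by
  have h5 : (pivots (![1, 1, 1, 1, 1] : Fin 5 → ZMod 2)).card = 5 := by decide
  have h0 : (pivots (0 : Fin (n - 5) → ZMod 2)).card = 0 := by simp [pivots]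
  have h := card_suffix_le_first_row (ferrers 5 (topVec n)) 0
    fun _ hc => suffix_mem_ferrers (by omega) (by rw [h5]; norm_num) _ hc
  omega

/-! ### Existence of the choices in the construction -/

lemma prefix_eq_of_concat_eq (hn : 5 ≤ n) {u u' : Fin 5 → ZMod 2} {s s' : Fin (n - 5) → ZMod 2}
    (h : concat n u s = concat n u' s') : u = u' := by
  funext c
  rw [← concat_prefixPos hn u s, h, concat_prefixPos]

lemma exists_isConstructionC5 [Finite F] (hn : 12 ≤ n)
    (D : Set (Submodule F (Fin (n - 5) → F))) : ∃ C, IsConstructionC5 n D C := by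
  have hfd : ∀ v : Fin n → ZMod 2, ∃ E : Submodule F (Matrix (Fin 5) (Fin n) F),
      (v = topVec n → IsFDMRD (ferrers 5 (topVec n)) 2 E) ∧
      ∀ i ∈ indices (Nat.card F) n, i.vec n = v → IsFDMRD (i.diagram n) 2 E := by
    intro v
    by_cases h : ∃ i ∈ indices (Nat.card F) n, i.vec n = v
    · obtain ⟨i, hi, rfl⟩ := h
      obtain ⟨E, hE⟩ := exists_isFDMRD (F := F) (i.diagram n) (diagram_top hn i)
        (five_le_card_first_row_diagram hn hi)
      refine ⟨E, fun h => ?_, fun i' hi' h => ?_⟩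
      · have hp := prefix_eq_of_concat_eq (by omega) h
        have hc := card_pivots_prefixes i.1.1 i.1.2
        rw [← Index.pre, hp] at hc
        exact absurd hc (by decide)
      · have hp : prefixes i'.1.1 i'.1.2 = prefixes i.1.1 i.1.2 :=
          prefix_eq_of_concat_eq (by omega) h
        have hinj : ∀ g g' : Fin 5, ∀ e e' : Fin 2, prefixes g e = prefixes g' e' → g = g' := by
          decide
        rwa [Index.diagram, h, hinj _ _ _ _ hp, ← Index.diagram]
    · obtain ⟨E, hE⟩ := exists_isFDMRD (F := F) (ferrers 5 (topVec n))
        (fun r c h => by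
          rw [mem_ferrers] at h ⊢
          exact ⟨h.1, by simp only [Fin.val_zero]; omega⟩)
        (five_le_card_first_row_topVec hn)
      exact ⟨E, fun _ => hE, fun i hi hv => absurd ⟨i, hi, hv⟩ h⟩
  choose fd hfd using hfd
  have : Fintype F := Fintype.ofFinite F
  obtain ⟨φ⟩ : Nonempty (classes (Nat.card F) n 4 ↪ F) := by
    apply Function.Embedding.nonempty_of_card_le
    rw [Fintype.card_coe, Fintype.card_eq_nat_card]
    exact card_classes_four_le _ _
  refine ⟨_, isConstructionC5_iff.2 ⟨fd,
    fun _ j => if h : j ∈ classes (Nat.card F) n 4 then φ ⟨j, h⟩ else 0,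
    (hfd _).1 rfl, fun i hi => (hfd _).2 i hi rfl, fun _ j hj j' hj' h => ?_, rfl⟩⟩
  have hj : j ∈ classes (Nat.card F) n 4 := hj
  have hj' : j' ∈ classes (Nat.card F) n 4 := hj'
  simp only [hj, hj', dif_pos] at h
  exact congrArg Subtype.val (φ.injective h)

/-! ### Intersections of codewords -/

lemma fill_apply_eq_zero {a : (Fin 5 → ZMod 2) → ℕ → F} {i : Index}
    {A : Matrix (Fin 5) (Fin n) F} (hA : ∀ r c, (r, c) ∉ i.diagram n → A r c = 0)
    (r : Fin 5) (c : Fin n) (h : (r, c) ∉ ferrers 5 (i.vec n)) : i.fill n a A r c = 0 := by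
  have h1 := hA r c fun h2 => h (diagram_subset i h2)
  unfold Index.fill
  split_ifs
  · have : (r, c) ∉ pendingDot 5 (i.vec n) := fun h2 => h (Finset.mem_filter.1 h2).1
    simp [withPending, this, h1]
  · exact h1

lemma fill_sub_fill {a : (Fin 5 → ZMod 2) → ℕ → F} {i : Index}
    {A B : Matrix (Fin 5) (Fin n) F} (hA : ∀ r c, (r, c) ∉ i.diagram n → A r c = 0)
    (hB : ∀ r c, (r, c) ∉ i.diagram n → B r c = 0) :
    i.fill n a A - i.fill n a B = A - B := by
  unfold Index.fill
  split_ifs with hg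
  · ext r c
    by_cases h : (r, c) ∈ pendingDot 5 (i.vec n)
    · have h1 : (r, c) ∉ i.diagram n := by
        rw [Index.diagram, if_pos hg]
        exact fun h2 => (Finset.mem_sdiff.1 h2).2 h
      simp [withPending, h, hA r c h1, hB r c h1]
    · simp [withPending, h]
  · rfl

/-- Codewords from one identifying vector: the rank distance is at least `2`. -/
lemma finrank_inf_block_le (hn : 12 ≤ n) {q : ℕ} {i : Index} (hi : i ∈ indices q n)
    {E : Submodule F (Matrix (Fin 5) (Fin n) F)} (hE : IsFDMRD (i.diagram n) 2 E)
    (a : (Fin 5 → ZMod 2) → ℕ → F) {A B : Matrix (Fin 5) (Fin n) F} (hA : A ∈ E) (hB : B ∈ E)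
    (hAB : A ≠ B) :
    finrank F (lift (i.vec n) (i.fill n a A) ⊓ lift (i.vec n) (i.fill n a B) :
      Submodule F (Fin n → F)) ≤ 3 := by
  have h1 := finrank_inf_lift_add_rank_le (card_pivots_vec hn hi)
    (fill_apply_eq_zero (a := a) (hE.1 A hA)) (fill_apply_eq_zero (a := a) (hE.1 B hB))
  rw [fill_sub_fill (hE.1 A hA) (hE.1 B hB)] at h1
  have h2 := hE.2.1 A hA B hB hAB
  omega

lemma finrank_inf_lift_topVec_le (hn : 12 ≤ n) {E : Submodule F (Matrix (Fin 5) (Fin n) F)}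
    (hE : IsFDMRD (ferrers 5 (topVec n)) 2 E) {A B : Matrix (Fin 5) (Fin n) F} (hA : A ∈ E)
    (hB : B ∈ E) (hAB : A ≠ B) :
    finrank F (lift (topVec n) A ⊓ lift (topVec n) B : Submodule F (Fin n → F)) ≤ 3 := by
  have h1 := finrank_inf_lift_add_rank_le (card_pivots_topVec hn) (hE.1 A hA) (hE.1 B hB)
  have h2 := hE.2.1 A hA B hB hAB
  omega

/-- Codewords of `𝒜₅` with the same prefix and suffixes from different classes: the two suffixes
may share a position, but the different values on the pending dot force the common vectors to
vanish at the first pivot, so that only three common pivots remain. -/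
lemma finrank_inf_le_of_pending (hn : 12 ≤ n) {q : ℕ} {e : Fin 2} {j j' : ℕ} {p p' : ℕ × ℕ}
    (hi : (⟨(4, e), j, p⟩ : Index) ∈ indices q n) (hi' : (⟨(4, e), j', p'⟩ : Index) ∈ indices q n)
    (hjj : j ≠ j') {a : (Fin 5 → ZMod 2) → ℕ → F}
    (ha : Set.InjOn (a (prefixes 4 e)) (classes q n 4))
    (A B : Matrix (Fin 5) (Fin n) F) :
    finrank F (lift (Index.vec n ⟨(4, e), j, p⟩) (Index.fill n a ⟨(4, e), j, p⟩ A) ⊓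
      lift (Index.vec n ⟨(4, e), j', p'⟩) (Index.fill n a ⟨(4, e), j', p'⟩ B) :
      Submodule F (Fin n → F)) ≤ 3 := by
  have hn5 : 5 ≤ n := by omega
  obtain ⟨hu0, hu1, -⟩ := isPendingPos_pendingPos e
  obtain ⟨hf0, hf1⟩ := firstPivotPos_spec e
  obtain ⟨hj, hp⟩ := mem_indices.1 hi
  obtain ⟨hj', hp'⟩ := mem_indices.1 hi'
  simp only at hj hj' hp hp'
  have hpp : (p.1, p.2) ≠ (p'.1, p'.2) := by
    intro h
    obtain ⟨h1, h2⟩ := bounds_of_mem_classes hn hj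
    obtain ⟨h3, h4⟩ := bounds_of_mem_classes hn hj'
    exact hjj (index_eq_of_mem_edges h1 h2 h3 h4 hp (h ▸ hp'))
  -- at the pending position, the entry is the entry at the first pivot times the value of the dot
  have hval : ∀ (j : ℕ) (p : ℕ × ℕ) (A : Matrix (Fin 5) (Fin n) F) (x : Fin n → F),
      x ∈ lift (Index.vec n ⟨(4, e), j, p⟩) (Index.fill n a ⟨(4, e), j, p⟩ A) →
      x (prefixPos hn5 (pendingPos e)) =
        x (prefixPos hn5 (firstPivotPos e)) * a (prefixes 4 e) j := by
    intro j p A x hx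
    rw [apply_eq_mul_of_onesBefore_eq_one hx (p := prefixPos hn5 (firstPivotPos e))
      (by rw [Index.vec, concat_prefixPos]; exact hf0)
      (by rw [Index.vec, onesBefore_concat_prefixPos]; exact hf1)
      (by rw [Index.vec, concat_prefixPos]
          have : prefixes 4 e (pendingPos e) ≠ 1 := by rw [hu0]; decide
          exact this)
      (by rw [Index.vec, onesBefore_concat_prefixPos]; exact hu1)]
    congr 1
    have : ((0 : Fin 5), prefixPos hn5 (pendingPos e)) ∈
        pendingDot 5 (Index.vec n ⟨(4, e), j, p⟩) := by
      rw [Index.vec, Index.pre, pendingDot_concat hn5 (isPendingPos_pendingPos e)]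
      exact Finset.mem_singleton_self _
    simp [Index.fill, withPending, this, Index.pre]
  have hx0 : ∀ x ∈ lift (Index.vec n ⟨(4, e), j, p⟩) (Index.fill n a ⟨(4, e), j, p⟩ A) ⊓
      lift (Index.vec n ⟨(4, e), j', p'⟩) (Index.fill n a ⟨(4, e), j', p'⟩ B),
      x (prefixPos hn5 (firstPivotPos e)) = 0 := by
    rintro x ⟨hx, hx'⟩
    have h := (hval j p A x hx).symm.trans (hval j' p' B x hx')
    rcases mul_eq_mul_left_iff.1 h with h | h
    · exact absurd (ha hj hj' h) hjj
    · exact h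
  refine (finrank_le_card_common_pivots (card_pivots_vec hn hi) (card_pivots_vec hn hi') _ le_rfl
    ((pivots (Index.vec n ⟨(4, e), j, p⟩) ∩ pivots (Index.vec n ⟨(4, e), j', p'⟩)).erase
      (prefixPos hn5 (firstPivotPos e))) ?_).trans ?_
  · intro x hx c h1 h2 h3
    by_cases hc : c = prefixPos hn5 (firstPivotPos e)
    · rw [hc]
      exact hx0 x hx
    · exact absurd (Finset.mem_erase.2 ⟨hc, Finset.mem_inter.2
        ⟨mem_pivots.2 h1, mem_pivots.2 h2⟩⟩) h3
  · rw [Finset.card_erase_of_mem]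
    · rw [Index.vec, Index.vec, card_pivots_concat_inter hn5]
      have h1 : (pivots (prefixes 4 e) ∩ pivots (prefixes 4 e)).card = 3 := by
        rw [Finset.inter_self, card_pivots_prefixes]
      have h2 := card_inter_pivots_of_ne (m := n - 5) (mem_edges.1 hp).2.1
        (mem_edges.1 hp').2.1 hpp
      simp only [Index.pre, Index.suf]
      omega
    · rw [Finset.mem_inter, mem_pivots, mem_pivots, Index.vec, Index.vec, concat_prefixPos,
        concat_prefixPos]
      exact ⟨hf0, hf0⟩

/-- Codewords with different identifying vectors. -/
lemma finrank_inf_le_of_index_ne (hn : 12 ≤ n) {q : ℕ} {i i' : Index} (hi : i ∈ indices q n)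
    (hi' : i' ∈ indices q n) (hii : i ≠ i') {a : (Fin 5 → ZMod 2) → ℕ → F}
    (ha : ∀ e, Set.InjOn (a (prefixes 4 e)) (classes q n 4))
    (A B : Matrix (Fin 5) (Fin n) F) :
    finrank F (lift (i.vec n) (i.fill n a A) ⊓ lift (i'.vec n) (i'.fill n a B) :
      Submodule F (Fin n → F)) ≤ 3 := by
  obtain ⟨⟨g, e⟩, j, p⟩ := i
  obtain ⟨⟨g', e'⟩, j', p'⟩ := i'
  obtain ⟨hj, hp⟩ := mem_indices.1 hi
  obtain ⟨hj', hp'⟩ := mem_indices.1 hi'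
  simp only at hj hj' hp hp'
  have hpiv := finrank_inf_lift_le_card_inter (card_pivots_vec hn hi) (card_pivots_vec hn hi')
    (Index.fill n a ⟨(g, e), j, p⟩ A) (Index.fill n a ⟨(g', e'), j', p'⟩ B)
  rw [Index.vec, Index.vec, card_pivots_concat_inter (by omega), ← Index.vec, ← Index.vec] at hpiv
  simp only [Index.pre, Index.suf] at hpiv
  by_cases hk : (g, e) = (g', e')
  · obtain ⟨rfl, rfl⟩ := Prod.mk.inj hk
    by_cases hjj : j = j'
    · subst hjj
      have hpp : (p.1, p.2) ≠ (p'.1, p'.2) := by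
        intro h
        apply hii
        rw [show p = p' from h]
      have h1 := card_inter_pivots_of_mem_edges hp hp' hpp
      rw [Finset.inter_self, card_pivots_prefixes] at hpiv
      omega
    · by_cases hg : g = 4
      · subst hg
        exact finrank_inf_le_of_pending hn hi hi' hjj (ha e) A B
      · exact absurd (eq_of_mem_classes hg hj hj') hjj
  · by_cases hg : g = g'
    · subst hg
      have he : e ≠ e' := fun h => hk (by rw [h])
      have h1 := card_inter_pivots_prefixes_of_pair (g := g) he
      have h2 : (pivots (edgeVector (n - 5) p.1 p.2) ∩
          pivots (edgeVector (n - 5) p'.1 p'.2)).card ≤ 2 :=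
        (Finset.card_le_card Finset.inter_subset_left).trans (card_pivots_of_mem_edges hp).le
      omega
    · have hpp : (p.1, p.2) ≠ (p'.1, p'.2) := by
        intro h
        obtain ⟨h1, h2⟩ := bounds_of_mem_classes hn hj
        obtain ⟨h3, h4⟩ := bounds_of_mem_classes hn hj'
        exact ne_of_mem_classes hn hg hj hj' (index_eq_of_mem_edges h1 h2 h3 h4 hp (h ▸ hp'))
      have h1 := card_inter_pivots_prefixes hk
      have h2 := card_inter_pivots_of_ne (m := n - 5) (mem_edges.1 hp).2.1
        (mem_edges.1 hp').2.1 hpp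
      omega

lemma prependZeros_injective (n : ℕ) : Function.Injective (prependZeros F n) := by
  intro y z h
  funext c
  have := congrFun h (suffixPos c)
  simpa [prependZeros, suffixPos] using this

/-- A subspace with five leading zero columns meets a lifted codeword in a subspace whose pivots
are pivots of the suffix. -/
lemma finrank_inf_map_prependZeros_le (hn : 5 ≤ n) {u : Fin 5 → ZMod 2}
    {s : Fin (n - 5) → ZMod 2} (hv : (pivots (concat n u s)).card = 5)
    (A : Matrix (Fin 5) (Fin n) F) (Y : Submodule F (Fin (n - 5) → F)) :
    finrank F (lift (concat n u s) A ⊓ Y.map (prependZeros F n) : Submodule F (Fin n → F)) ≤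
      (pivots s).card := by
  rw [← Finset.card_image_of_injective (pivots s) suffixPos_injective]
  refine finrank_le_card_common_pivots hv hv _ (A := A) (B := A)
    (by rw [inf_idem]; exact inf_le_left) _ ?_
  rintro x ⟨-, y, -, rfl⟩ c hc - hcT
  by_cases h : c.val < 5
  · simp [prependZeros, h]
  · obtain ⟨d, rfl⟩ : ∃ d : Fin (n - 5), c = suffixPos d :=
      ⟨⟨c.val - 5, by omega⟩, Fin.ext (by simp [suffixPos]; omega)⟩
    rw [concat_suffixPos] at hc
    exact absurd (Finset.mem_image_of_mem _ (mem_pivots.2 hc)) hcT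

end Blocks

/-! ### Parameters of the code -/

section Parameters

variable {F : Type*} [Field F] {n : ℕ}

lemma subspaceDist_of_finrank_eq_five {X Y : Submodule F (Fin n → F)} (hX : finrank F X = 5)
    (hY : finrank F Y = 5) :
    subspaceDist X Y = 10 - 2 * finrank F (X ⊓ Y : Submodule F (Fin n → F)) := by
  rw [subspaceDist, hX, hY]

lemma ncard_biUnion_finset {ι α : Type*} (s : Finset ι) (t : ι → Set α)
    (hfin : ∀ i ∈ s, (t i).Finite)
    (hdisj : ∀ i ∈ s, ∀ j ∈ s, i ≠ j → Disjoint (t i) (t j)) :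
    (⋃ i ∈ s, t i).ncard = ∑ i ∈ s, (t i).ncard := by
  classical
  induction s using Finset.induction_on with
  | empty => simp
  | insert i s hi ih =>
    have hfin' : (⋃ j ∈ s, t j).Finite :=
      s.finite_toSet.biUnion fun j hj => hfin j (Finset.mem_insert_of_mem hj)
    rw [Finset.sum_insert hi, Finset.set_biUnion_insert,
      Set.ncard_union_eq ?_ (hfin i (Finset.mem_insert_self _ _)) hfin',
      ih (fun j hj => hfin j (Finset.mem_insert_of_mem hj))
        (fun j hj k hk => hdisj j (Finset.mem_insert_of_mem hj) k (Finset.mem_insert_of_mem hk))]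
    rw [Set.disjoint_iUnion₂_right]
    exact fun j hj => hdisj i (Finset.mem_insert_self _ _) j (Finset.mem_insert_of_mem hj)
      (fun h => hi (h ▸ hj))

/-- Sets of five-dimensional subspaces whose members intersect in dimension at most `3` are
disjoint. -/
lemma disjoint_of_finrank_inf_le {S T : Set (Submodule F (Fin n → F))}
    (hS : ∀ X ∈ S, finrank F X = 5)
    (h : ∀ X ∈ S, ∀ Y ∈ T, finrank F (X ⊓ Y : Submodule F (Fin n → F)) ≤ 3) : Disjoint S T := by
  rw [Set.disjoint_left]
  intro X hX hX'
  have h1 := h X hX X hX'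
  rw [inf_idem, hS X hX] at h1
  omega

/-- The lifting map is injective on a set of matrices giving small intersections. -/
lemma injOn_of_finrank_inf_le {M : Set (Matrix (Fin 5) (Fin n) F)}
    {f : Matrix (Fin 5) (Fin n) F → Submodule F (Fin n → F)} (hf : ∀ A, finrank F (f A) = 5)
    (h : ∀ A ∈ M, ∀ B ∈ M, A ≠ B → finrank F (f A ⊓ f B : Submodule F (Fin n → F)) ≤ 3) :
    Set.InjOn f M := by
  intro A hA B hB he
  by_contra hne
  have h1 := h A hA B hB hne
  rw [he, inf_idem, hf] at h1
  omega

lemma finrank_inf_map_map_le {Y Z : Submodule F (Fin (n - 5) → F)} (hY : finrank F Y = 5)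
    (hZ : finrank F Z = 5) (h : 2 ≤ injectionDist Y Z) :
    finrank F (Y.map (prependZeros F n) ⊓ Z.map (prependZeros F n) :
      Submodule F (Fin n → F)) ≤ 3 := by
  rw [← Submodule.map_inf _ (prependZeros_injective n),
    ← (Submodule.equivMapOfInjective _ (prependZeros_injective n) (Y ⊓ Z)).finrank_eq]
  rw [injectionDist, hY, hZ] at h
  omega

/-- The lifted MRD code contains a codeword at distance `4` from the zero matrix: the matrices of
the code that vanish outside the first two rows form a nonzero space, by counting dimensions. -/
lemma exists_ne_zero_last_rows_eq_zero (hn : 12 ≤ n)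
    {E : Submodule F (Matrix (Fin 5) (Fin n) F)} (hE : IsFDMRD (ferrers 5 (topVec n)) 2 E) :
    ∃ A ∈ E, A ≠ 0 ∧ ∀ r : Fin 5, 2 ≤ r.val → ∀ c, A r c = 0 := by
  have hrank : finrank F E = 4 * (n - 5) :=
    ((isLeast_dotsRemaining_iff (five_le_card_first_row_topVec hn) _).1 hE.2.2).trans
      (dotsRemaining_ferrers_topVec hn)
  let f : E →ₗ[F] (Fin 3 × Fin (n - 5) → F) :=
    { toFun := fun A p => A.1 (Fin.natAdd 2 p.1) (suffixPos p.2)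
      map_add' := fun A B => rfl
      map_smul' := fun t A => rfl }
  have hker : LinearMap.ker f ≠ ⊥ := by
    intro h
    have := LinearMap.finrank_le_finrank_of_injective (LinearMap.ker_eq_bot.1 h)
    rw [hrank, Module.finrank_fintype_fun_eq_card, Fintype.card_prod, Fintype.card_fin,
      Fintype.card_fin] at this
    omega
  obtain ⟨⟨A, hA⟩, hAker, hA0⟩ := Submodule.exists_mem_ne_zero_of_ne_bot hker
  refine ⟨A, hA, fun h => hA0 (Subtype.ext h), fun r hr c => ?_⟩
  by_cases hc : c.val < 5
  · apply hE.1 A hA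
    rw [mem_ferrers]
    rintro ⟨h0, -⟩
    have hn5 : 5 ≤ n := by omega
    have hone : ∀ d : Fin 5, (![1, 1, 1, 1, 1] : Fin 5 → ZMod 2) d ≠ 0 := by decide
    obtain ⟨d, rfl⟩ : ∃ d : Fin 5, c = prefixPos hn5 d := ⟨⟨c.val, hc⟩, rfl⟩
    rw [topVec, concat_prefixPos] at h0
    exact hone d h0
  · obtain ⟨d, rfl⟩ : ∃ d : Fin (n - 5), c = suffixPos d :=
      ⟨⟨c.val - 5, by omega⟩, Fin.ext (by simp [suffixPos]; omega)⟩
    have h1 := congrFun (LinearMap.mem_ker.1 hAker) (⟨r.val - 2, by omega⟩, d)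
    have h2 : (Fin.natAdd 2 (⟨r.val - 2, by omega⟩ : Fin 3) : Fin 5) = r :=
      Fin.ext (by simp; omega)
    change A (Fin.natAdd 2 (⟨r.val - 2, by omega⟩ : Fin 3)) (suffixPos d) = 0 at h1
    rwa [h2] at h1

variable [Finite F] {D : Set (Submodule F (Fin (n - 5) → F))} {C : Set (Submodule F (Fin n → F))}

/-- Dimension, pairwise intersections and cardinality of a code obtained by the construction. -/
lemma parameters_of_isConstructionC5 (hn : 12 ≤ n) (hD : ∀ Y ∈ D, finrank F Y = 5)
    (hDdist : ∀ Y ∈ D, ∀ Z ∈ D, Y ≠ Z → 2 ≤ injectionDist Y Z) (hC : IsConstructionC5 n D C) :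
    (∀ X ∈ C, finrank F X = 5) ∧
    (∀ X ∈ C, ∀ Y ∈ C, X ≠ Y → finrank F (X ⊓ Y : Submodule F (Fin n → F)) ≤ 3) ∧
    (∃ X ∈ C, ∃ Y ∈ C, X ≠ Y ∧ 3 ≤ finrank F (X ⊓ Y : Submodule F (Fin n → F))) ∧
    C.ncard = Nat.card F ^ (4 * (n - 5)) +
      ∑ i ∈ indices (Nat.card F) n, Nat.card F ^ dotsRemaining (i.diagram n) 2 1 + D.ncard := by
  obtain ⟨fd, a, htop, hfd, ha, rfl⟩ := isConstructionC5_iff.1 hC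
  set C₀ := lift (topVec n) '' (fd (topVec n) : Set (Matrix (Fin 5) (Fin n) F)) with hC₀
  set C₁ := ⋃ i ∈ indices (Nat.card F) n, i.block n fd a with hC₁
  set C₂ := (fun Y => Submodule.map (prependZeros F n) Y) '' D with hC₂
  have dim₀ : ∀ X ∈ C₀, finrank F X = 5 := by
    rintro _ ⟨A, -, rfl⟩
    exact finrank_lift (card_pivots_topVec hn) A
  have dimb : ∀ i ∈ indices (Nat.card F) n, ∀ X ∈ i.block n fd a, finrank F X = 5 := by
    rintro i hi _ ⟨A, -, rfl⟩
    exact finrank_lift (card_pivots_vec hn hi) _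
  have dim₁ : ∀ X ∈ C₁, finrank F X = 5 := by
    intro X hX
    obtain ⟨i, hi, hX⟩ := Set.mem_iUnion₂.1 hX
    exact dimb i hi X hX
  have dim₂ : ∀ X ∈ C₂, finrank F X = 5 := by
    rintro _ ⟨Y, hY, rfl⟩
    rw [← (Submodule.equivMapOfInjective _ (prependZeros_injective n) Y).finrank_eq, hD Y hY]
  have h00 : ∀ X ∈ C₀, ∀ Y ∈ C₀, X ≠ Y → finrank F (X ⊓ Y : Submodule F (Fin n → F)) ≤ 3 := by
    rintro _ ⟨A, hA, rfl⟩ _ ⟨B, hB, rfl⟩ hne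
    exact finrank_inf_lift_topVec_le hn htop hA hB fun h => hne (by rw [h])
  have h01 : ∀ X ∈ C₀, ∀ Y ∈ C₁, finrank F (X ⊓ Y : Submodule F (Fin n → F)) ≤ 3 := by
    rintro _ ⟨A, hA, rfl⟩ Y hY
    obtain ⟨i, hi, B, hB, rfl⟩ := Set.mem_iUnion₂.1 hY
    exact (finrank_inf_lift_le_card_inter (card_pivots_topVec hn) (card_pivots_vec hn hi) _
      _).trans (card_inter_pivots_topVec hn i)
  have h02 : ∀ X ∈ C₀, ∀ Y ∈ C₂, finrank F (X ⊓ Y : Submodule F (Fin n → F)) ≤ 3 := by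
    rintro _ ⟨A, hA, rfl⟩ _ ⟨Y, hY, rfl⟩
    refine (finrank_inf_map_prependZeros_le (by omega) (card_pivots_topVec hn) A Y).trans ?_
    simp [pivots]
  have hbb : ∀ i ∈ indices (Nat.card F) n, ∀ j ∈ indices (Nat.card F) n, i ≠ j →
      ∀ X ∈ i.block n fd a, ∀ Y ∈ j.block n fd a,
        finrank F (X ⊓ Y : Submodule F (Fin n → F)) ≤ 3 := by
    rintro i hi j hj hij _ ⟨A, hA, rfl⟩ _ ⟨B, hB, rfl⟩
    exact finrank_inf_le_of_index_ne hn hi hj hij ha A B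
  have h11 : ∀ X ∈ C₁, ∀ Y ∈ C₁, X ≠ Y → finrank F (X ⊓ Y : Submodule F (Fin n → F)) ≤ 3 := by
    intro X hX Y hY hne
    obtain ⟨i, hi, hX⟩ := Set.mem_iUnion₂.1 hX
    obtain ⟨j, hj, hY⟩ := Set.mem_iUnion₂.1 hY
    by_cases hij : i = j
    · subst hij
      obtain ⟨A, hA, rfl⟩ := hX
      obtain ⟨B, hB, rfl⟩ := hY
      exact finrank_inf_block_le hn hi (hfd i hi) a hA hB fun h => hne (by rw [h])
    · exact hbb i hi j hj hij X hX Y hY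
  have h12 : ∀ X ∈ C₁, ∀ Y ∈ C₂, finrank F (X ⊓ Y : Submodule F (Fin n → F)) ≤ 3 := by
    rintro X hX _ ⟨Y, hY, rfl⟩
    obtain ⟨i, hi, A, hA, rfl⟩ := Set.mem_iUnion₂.1 hX
    refine (finrank_inf_map_prependZeros_le (by omega) (card_pivots_vec hn hi) _ Y).trans ?_
    rw [card_pivots_suf hi]
    norm_num
  have h22 : ∀ X ∈ C₂, ∀ Y ∈ C₂, X ≠ Y → finrank F (X ⊓ Y : Submodule F (Fin n → F)) ≤ 3 := by
    rintro _ ⟨Y, hY, rfl⟩ _ ⟨Z, hZ, rfl⟩ hne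
    exact finrank_inf_map_map_le (hD Y hY) (hD Z hZ)
      (hDdist Y hY Z hZ fun h => hne (by rw [h]))
  refine ⟨?_, ?_, ?_, ?_⟩
  · rintro X ((h | h) | h)
    exacts [dim₀ X h, dim₁ X h, dim₂ X h]
  · rintro X ((hX | hX) | hX) Y ((hY | hY) | hY) hne
    · exact h00 X hX Y hY hne
    · exact h01 X hX Y hY
    · exact h02 X hX Y hY
    · rw [inf_comm]; exact h01 Y hY X hX
    · exact h11 X hX Y hY hne
    · exact h12 X hX Y hY
    · rw [inf_comm]; exact h02 Y hY X hX
    · rw [inf_comm]; exact h12 Y hY X hX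
    · exact h22 X hX Y hY hne
  · obtain ⟨A, hA, hA0, hArows⟩ := exists_ne_zero_last_rows_eq_zero hn htop
    have hinf : 3 ≤ finrank F (lift (topVec n) A ⊓ lift (topVec n) 0 :
        Submodule F (Fin n → F)) :=
      card_le_finrank_inf_lift (card_pivots_topVec hn) {2, 3, 4} (by
        intro r hr c
        refine hArows r ?_ c
        revert hr
        revert r
        decide)
    refine ⟨_, Or.inl (Or.inl ⟨A, hA, rfl⟩), _, Or.inl (Or.inl ⟨0, (fd _).zero_mem, rfl⟩),
      fun h => ?_, hinf⟩
    have h1 := finrank_inf_lift_topVec_le hn htop hA (fd _).zero_mem hA0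
    rw [h, inf_idem, finrank_lift (card_pivots_topVec hn)] at h1
    omega
  · have hfin : ∀ S : Set (Submodule F (Fin n → F)), S.Finite := fun S => Set.toFinite S
    rw [Set.ncard_union_eq ?_ (hfin _) (hfin _), Set.ncard_union_eq ?_ (hfin _) (hfin _)]
    · have hc₀ : C₀.ncard = Nat.card F ^ (4 * (n - 5)) := by
        rw [hC₀, Set.InjOn.ncard_image (injOn_of_finrank_inf_le
          (fun A => finrank_lift (card_pivots_topVec hn) A)
          fun A hA B hB hAB => finrank_inf_lift_topVec_le hn htop hA hB hAB),
          ← Nat.card_coe_set_eq]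
        refine (Module.natCard_eq_pow_finrank (K := F) (V := fd (topVec n))).trans ?_
        rw [(isLeast_dotsRemaining_iff (five_le_card_first_row_topVec hn) _).1 htop.2.2,
          dotsRemaining_ferrers_topVec hn]
      have hc₁ : C₁.ncard =
          ∑ i ∈ indices (Nat.card F) n, Nat.card F ^ dotsRemaining (i.diagram n) 2 1 := by
        rw [hC₁, ncard_biUnion_finset _ _ (fun _ _ => hfin _) fun i hi j hj hij =>
          disjoint_of_finrank_inf_le (dimb i hi) (hbb i hi j hj hij)]
        refine Finset.sum_congr rfl fun i hi => ?_
        rw [Index.block, Set.InjOn.ncard_image (injOn_of_finrank_inf_le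
          (fun A => finrank_lift (card_pivots_vec hn hi) _)
          fun A hA B hB hAB => finrank_inf_block_le hn hi (hfd i hi) a hA hB hAB),
          ← Nat.card_coe_set_eq]
        refine (Module.natCard_eq_pow_finrank (K := F) (V := fd (i.vec n))).trans ?_
        rw [(isLeast_dotsRemaining_iff (five_le_card_first_row_diagram hn hi) _).1
          (hfd i hi).2.2]
      have hc₂ : C₂.ncard = D.ncard := Set.ncard_image_of_injective _
        (Submodule.map_injective_of_injective (prependZeros_injective (F := F) n))
      rw [hc₀, hc₁, hc₂]
    · exact disjoint_of_finrank_inf_le dim₀ h01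
    · exact disjoint_of_finrank_inf_le
        (by rintro X (h | h); exacts [dim₀ X h, dim₁ X h])
        (by rintro X (h | h); exacts [h02 X h, h12 X h])

end Parameters

/-! ### The cardinality -/

section Cardinality

/-- The contribution to the cardinality of a prefix with `P` dots outside the first row and the
class `P_j`. -/
noncomputable def classSum (q n P j : ℕ) : ℚ :=
  ∑ p ∈ edges (n - 5) j, (q : ℚ) ^ (4 * (n : ℤ) - 25 + P - ((p.1 + p.2 : ℕ) : ℤ))

lemma classSum_ceilHalf_add_even {q n i : ℕ} (hq : q ≠ 0) (hn : 12 ≤ n) (hev : Even n) (P : ℕ)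
    (hi : 1 ≤ i) (hi' : i ≤ floorHalf (n - 5)) :
    classSum q n P (ceilHalf (n - 5) + i) = (q : ℚ) ^ (2 * (n : ℤ) - 14 + P) *
      ((i : ℚ) * (q : ℚ) ^ (2 * (n : ℤ) - 2 * (i : ℤ) - 12)
        + (((n : ℚ) - 6) / 2 - (i : ℚ)) * (q : ℚ) ^ ((n : ℤ) - 2 * (i : ℤ) - 7)) := by
  obtain ⟨h, rfl⟩ : ∃ h, n = 2 * h + 6 := by
    obtain ⟨k, rfl⟩ := hev
    exact ⟨k - 3, by omega⟩
  have hq0 : (q : ℚ) ≠ 0 := Nat.cast_ne_zero.2 hq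
  have hm : 2 * h + 6 - 5 = 2 * h + 1 := by omega
  simp only [floorHalf, hm] at hi'
  rw [classSum, hm, show ceilHalf (2 * h + 1) + i = h + 1 + i by rw [ceilHalf]; omega,
    sum_edges_ceilHalf_add_odd hi (by omega)
      (fun t => (q : ℚ) ^ (4 * ((2 * h + 6 : ℕ) : ℤ) - 25 + P - (t : ℤ)))]
  rw [mul_add, mul_left_comm, ← zpow_add₀ hq0, mul_left_comm, ← zpow_add₀ hq0]
  push_cast
  congr 2
  · congr 1; ring
  · ring
  · congr 1; ring

lemma classSum_succ_even {q n i : ℕ} (hq : q ≠ 0) (hn : 12 ≤ n) (hev : Even n) (P : ℕ)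
    (hi : 1 ≤ i) (hi' : i ≤ ceilHalf (n - 5) - 1) :
    classSum q n P (i + 1) = (q : ℚ) ^ (2 * (n : ℤ) - 14 + P) *
      ((i : ℚ) * (q : ℚ) ^ (2 * (n : ℤ) - 2 * (i : ℤ) - 13)
        + (((n : ℚ) - 6) / 2 - (i : ℚ)) * (q : ℚ) ^ ((n : ℤ) - 2 * (i : ℤ) - 8)) := by
  obtain ⟨h, rfl⟩ : ∃ h, n = 2 * h + 6 := by
    obtain ⟨k, rfl⟩ := hev
    exact ⟨k - 3, by omega⟩
  have hq0 : (q : ℚ) ≠ 0 := Nat.cast_ne_zero.2 hq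
  have hm : 2 * h + 6 - 5 = 2 * h + 1 := by omega
  simp only [ceilHalf, hm] at hi'
  rw [classSum, hm, sum_edges_succ_odd hi (by omega)
      (fun t => (q : ℚ) ^ (4 * ((2 * h + 6 : ℕ) : ℤ) - 25 + P - (t : ℤ)))]
  rw [mul_add, mul_left_comm, ← zpow_add₀ hq0, mul_left_comm, ← zpow_add₀ hq0]
  push_cast
  congr 2
  · congr 1; ring
  · ring
  · congr 1; ring

lemma classSum_ceilHalf_add_odd {q n i : ℕ} (hq : q ≠ 0) (hn : 12 ≤ n) (hodd : Odd n) (P : ℕ)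
    (hi : 1 ≤ i) (hi' : i ≤ floorHalf (n - 5)) :
    classSum q n P (ceilHalf (n - 5) + i) = (q : ℚ) ^ (2 * (n : ℤ) - 14 + P) *
      ((i : ℚ) * (q : ℚ) ^ (2 * (n : ℤ) - 2 * (i : ℤ) - 12)
        + (((n : ℚ) - 7) / 2 - (i : ℚ)) * (q : ℚ) ^ ((n : ℤ) - 2 * (i : ℤ) - 6)
        + (q : ℚ) ^ (((n : ℤ) - 7) / 2 - (i : ℤ))) := by
  obtain ⟨h, rfl⟩ : ∃ h, n = 2 * h + 5 := by
    obtain ⟨k, rfl⟩ := hodd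
    exact ⟨k - 2, by omega⟩
  have hq0 : (q : ℚ) ≠ 0 := Nat.cast_ne_zero.2 hq
  have hm : 2 * h + 5 - 5 = 2 * h := by omega
  simp only [floorHalf, hm] at hi'
  rw [classSum, hm, show ceilHalf (2 * h) + i = h + i by rw [ceilHalf]; omega,
    sum_edges_ceilHalf_add_even hi (by omega)
      (fun t => (q : ℚ) ^ (4 * ((2 * h + 5 : ℕ) : ℤ) - 25 + P - (t : ℤ))),
    show (((2 * h + 5 : ℕ) : ℤ) - 7) / 2 = h - 1 by push_cast; omega]
  rw [mul_add, mul_add, mul_left_comm, ← zpow_add₀ hq0, mul_left_comm, ← zpow_add₀ hq0,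
    ← zpow_add₀ hq0]
  push_cast
  congr 2
  · congr 2; ring
  · congr 1
    · ring
    · congr 1; ring
  · ring

lemma classSum_succ_odd {q n i : ℕ} (hq : q ≠ 0) (hn : 12 ≤ n) (hodd : Odd n) (P : ℕ)
    (hi : 1 ≤ i) (hi' : i ≤ ceilHalf (n - 5) - 1) :
    classSum q n P (i + 1) = (q : ℚ) ^ (2 * (n : ℤ) - 14 + P) *
      ((i : ℚ) * (q : ℚ) ^ (2 * (n : ℤ) - 2 * (i : ℤ) - 13)
        + (((n : ℚ) - 7) / 2 - (i : ℚ)) * (q : ℚ) ^ ((n : ℤ) - 2 * (i : ℤ) - 7)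
        + (q : ℚ) ^ ((n : ℤ) - (i : ℤ) - 7)) := by
  obtain ⟨h, rfl⟩ : ∃ h, n = 2 * h + 5 := by
    obtain ⟨k, rfl⟩ := hodd
    exact ⟨k - 2, by omega⟩
  have hq0 : (q : ℚ) ≠ 0 := Nat.cast_ne_zero.2 hq
  have hm : 2 * h + 5 - 5 = 2 * h := by omega
  simp only [ceilHalf, hm] at hi'
  rw [classSum, hm, sum_edges_succ_even hi (by omega)
      (fun t => (q : ℚ) ^ (4 * ((2 * h + 5 : ℕ) : ℤ) - 25 + P - (t : ℤ)))]
  rw [mul_add, mul_add, mul_left_comm, ← zpow_add₀ hq0, mul_left_comm, ← zpow_add₀ hq0,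
    ← zpow_add₀ hq0]
  push_cast
  congr 2
  · congr 2; ring
  · congr 1
    · ring
    · congr 1; ring
  · ring

lemma sum_indices_eq_sum_classSum {q n : ℕ} (hq : q ≠ 0) (hn : 12 ≤ n) :
    ((∑ i ∈ indices q n, q ^ dotsRemaining (i.diagram n) 2 1 : ℕ) : ℚ) =
      ∑ g, ∑ e, ∑ j ∈ classes q n g, classSum q n (prefixDots (prefixes g e)) j := by
  have hq0 : (q : ℚ) ≠ 0 := Nat.cast_ne_zero.2 hq
  rw [← Fintype.sum_prod_type', Nat.cast_sum]
  have hterm : ∀ i ∈ indices q n, ((q ^ dotsRemaining (i.diagram n) 2 1 : ℕ) : ℚ) =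
      (q : ℚ) ^ (4 * (n : ℤ) - 25 + prefixDots i.pre - ((i.2.2.1 + i.2.2.2 : ℕ) : ℤ)) := by
    intro i hi
    rw [Nat.cast_pow, ← zpow_natCast]
    congr 1
    have := dotsRemaining_diagram hn hi
    omega
  rw [Finset.sum_congr rfl hterm, indices, Finset.sum_sigma]
  refine Finset.sum_congr rfl fun k _ => ?_
  rw [Finset.sum_sigma]
  rfl

/-- Summation over all classes, in terms of the factors `E i` and `O i` of the classes with sums
of end points congruent to `2 i + 1` and `2 i + 2`, respectively. -/
lemma sum_classSum {q n : ℕ} (hn : 12 ≤ n) (E O : ℕ → ℚ)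
    (hE : ∀ P i, 1 ≤ i → i ≤ floorHalf (n - 5) →
      classSum q n P (ceilHalf (n - 5) + i) = (q : ℚ) ^ (2 * (n : ℤ) - 14 + P) * E i)
    (hO : ∀ P i, 1 ≤ i → i ≤ ceilHalf (n - 5) - 1 →
      classSum q n P (i + 1) = (q : ℚ) ^ (2 * (n : ℤ) - 14 + P) * O i) :
    ∑ g, ∑ e, ∑ j ∈ classes q n g, classSum q n (prefixDots (prefixes g e)) j =
      ((q : ℚ) ^ (2 * (n : ℤ) - 10) + (q : ℚ) ^ (2 * (n : ℤ) - 14)) * E 1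
      + ((q : ℚ) ^ (2 * (n : ℤ) - 11) + (q : ℚ) ^ (2 * (n : ℤ) - 13)) * O 1
      + ((q : ℚ) ^ (2 * (n : ℤ) - 12) + (q : ℚ) ^ (2 * (n : ℤ) - 13)) * E 2
      + ((q : ℚ) ^ (2 * (n : ℤ) - 12) + (q : ℚ) ^ (2 * (n : ℤ) - 14)) *
        (∑ i ∈ Finset.Icc 3 (min (ceilHalf q + 2) (floorHalf (n - 5))), E i
          + ∑ i ∈ Finset.Icc 2 (min (floorHalf q + 2) (ceilHalf (n - 5) - 1)), O i) := by
  have hf : 3 ≤ floorHalf (n - 5) := by rw [floorHalf]; omega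
  have hc : 4 ≤ ceilHalf (n - 5) := by rw [ceilHalf]; omega
  -- the indices `j = i + 1` of the last group
  have hfour : ∀ P, ∑ j ∈ classes q n 4, classSum q n P j =
      (q : ℚ) ^ (2 * (n : ℤ) - 14 + P) *
        (∑ i ∈ Finset.Icc 3 (min (ceilHalf q + 2) (floorHalf (n - 5))), E i
          + ∑ i ∈ Finset.Icc 3 (min (floorHalf q + 2) (ceilHalf (n - 5) - 1)), O i) := by
    intro P
    have h4 : classes q n 4 =
      (Finset.Icc 3 (min (ceilHalf q + 2) (floorHalf (n - 5)))).image (ceilHalf (n - 5) + ·) ∪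
        (Finset.Icc 3 (min (floorHalf q + 2) (ceilHalf (n - 5) - 1))).image (· + 1) := by
      have : classes q n 4 =
        (Finset.Icc 3 (min (ceilHalf q + 2) (floorHalf (n - 5)))).image (ceilHalf (n - 5) + ·) ∪
          Finset.Icc 4 (min (floorHalf q + 3) (ceilHalf (n - 5))) := rfl
      rw [this, Finset.image_add_right_Icc]
      congr 2
      omega
    rw [h4, Finset.sum_union, Finset.sum_image (by simp), Finset.sum_image (by simp), mul_add,
      Finset.mul_sum, Finset.mul_sum]
    · congr 1
      · refine Finset.sum_congr rfl fun i hi => ?_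
        rw [Finset.mem_Icc, le_min_iff] at hi
        exact hE P i (by omega) hi.2.2
      · refine Finset.sum_congr rfl fun i hi => ?_
        rw [Finset.mem_Icc, le_min_iff] at hi
        exact hO P i (by omega) hi.2.2
    · rw [Finset.disjoint_left]
      simp only [Finset.mem_image, Finset.mem_Icc, le_min_iff]
      rintro _ ⟨i, hi, rfl⟩ ⟨i', hi', h⟩
      omega
  have htwo : ∑ i ∈ Finset.Icc 2 (min (floorHalf q + 2) (ceilHalf (n - 5) - 1)), O i =
      O 2 + ∑ i ∈ Finset.Icc 3 (min (floorHalf q + 2) (ceilHalf (n - 5) - 1)), O i := by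
    rw [← Finset.insert_Icc_succ_left_eq_Icc (by rw [le_min_iff]; omega), Finset.sum_insert]
    · rfl
    · simp
  have hP : prefixDots (prefixes 0 0) = 4 ∧ prefixDots (prefixes 0 1) = 0 ∧
      prefixDots (prefixes 1 0) = 3 ∧ prefixDots (prefixes 1 1) = 1 ∧
      prefixDots (prefixes 2 0) = 2 ∧ prefixDots (prefixes 2 1) = 1 ∧
      prefixDots (prefixes 3 0) = 0 ∧ prefixDots (prefixes 3 1) = 2 ∧
      prefixDots (prefixes 4 0) = 2 ∧ prefixDots (prefixes 4 1) = 0 := by decide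
  obtain ⟨h00, h01, h10, h11, h20, h21, h30, h31, h40, h41⟩ := hP
  have hc0 : ∀ P, ∑ j ∈ classes q n 0, classSum q n P j =
      (q : ℚ) ^ (2 * (n : ℤ) - 14 + P) * E 1 := fun P =>
    (Finset.sum_singleton _ _).trans (hE P 1 le_rfl (by omega))
  have hc1 : ∀ P, ∑ j ∈ classes q n 1, classSum q n P j =
      (q : ℚ) ^ (2 * (n : ℤ) - 14 + P) * O 1 := fun P =>
    (Finset.sum_singleton _ _).trans (hO P 1 le_rfl (by omega))
  have hc2 : ∀ P, ∑ j ∈ classes q n 2, classSum q n P j =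
      (q : ℚ) ^ (2 * (n : ℤ) - 14 + P) * E 2 := fun P =>
    (Finset.sum_singleton _ _).trans (hE P 2 (by omega) (by omega))
  have hc3 : ∀ P, ∑ j ∈ classes q n 3, classSum q n P j =
      (q : ℚ) ^ (2 * (n : ℤ) - 14 + P) * O 2 := fun P =>
    (Finset.sum_singleton _ _).trans (hO P 2 (by omega) (by omega))
  simp only [Fin.sum_univ_five, Fin.sum_univ_two, h00, h01, h10, h11, h20, h21, h30, h31, h40,
    h41, hc0, hc1, hc2, hc3, hfour, htwo]
  have e10 : 2 * (n : ℤ) - 14 + (4 : ℕ) = 2 * n - 10 := by push_cast; ring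
  have e11 : 2 * (n : ℤ) - 14 + (3 : ℕ) = 2 * n - 11 := by push_cast; ring
  have e12 : 2 * (n : ℤ) - 14 + (2 : ℕ) = 2 * n - 12 := by push_cast; ring
  have e13 : 2 * (n : ℤ) - 14 + (1 : ℕ) = 2 * n - 13 := by push_cast; ring
  have e14 : 2 * (n : ℤ) - 14 + (0 : ℕ) = 2 * n - 14 := by push_cast; ring
  rw [e10, e11, e12, e13, e14]
  ring

end Cardinality

end SubspaceCodes

theorem mainTheorem9 (F : Type*) [Field F] [Finite F] (q : ℕ) (hq : Nat.card F = q)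
    (n : ℕ) (hn : 12 ≤ n)
    -- a code of 5-dimensional subspaces of `F ^ (n - 5)` with injection distance at least 2
    (D : Set (Submodule F (Fin (n - 5) → F)))
    (hD : ∀ Y ∈ D, Module.finrank F Y = 5)
    (hDdist : ∀ Y ∈ D, ∀ Z ∈ D, Y ≠ Z → 2 ≤ SubspaceCodes.injectionDist Y Z)
    (Astar : ℕ) (hA : D.ncard = Astar) :
    -- the construction can be carried out
    (∃ C : Set (Submodule F (Fin n → F)), SubspaceCodes.IsConstructionC5 n D C) ∧
    -- every code obtained by it has the stated parameters
    ∀ C : Set (Submodule F (Fin n → F)), SubspaceCodes.IsConstructionC5 n D C →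
      (∀ X ∈ C, Module.finrank F X = 5) ∧
      IsLeast (SubspaceCodes.subspaceDistances C) 4 ∧
      (Even n →
        (C.ncard : ℚ) =
          (q : ℚ) ^ (4 * ((n : ℤ) - 5))
          + ((q : ℚ) ^ (2 * (n : ℤ) - 10) + (q : ℚ) ^ (2 * (n : ℤ) - 14))
            * ((q : ℚ) ^ (2 * ((n : ℤ) - 7)) + ((n : ℚ) - 8) / 2 * (q : ℚ) ^ ((n : ℤ) - 9))
          + ((q : ℚ) ^ (2 * (n : ℤ) - 11) + (q : ℚ) ^ (2 * (n : ℤ) - 13))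
            * (((n : ℚ) - 8) / 2 * (q : ℚ) ^ ((n : ℤ) - 10) + (q : ℚ) ^ (2 * (n : ℤ) - 15))
          + ((q : ℚ) ^ (2 * (n : ℤ) - 12) + (q : ℚ) ^ (2 * (n : ℤ) - 13))
            * (2 * (q : ℚ) ^ (2 * ((n : ℤ) - 8))
              + ((n : ℚ) - 10) / 2 * (q : ℚ) ^ ((n : ℤ) - 11))
          + ((q : ℚ) ^ (2 * (n : ℤ) - 12) + (q : ℚ) ^ (2 * (n : ℤ) - 14))
            * ((∑ i ∈ Finset.Icc 3 (min (SubspaceCodes.ceilHalf q + 2)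
                    (SubspaceCodes.floorHalf (n - 5))),
                  ((i : ℚ) * (q : ℚ) ^ (2 * (n : ℤ) - 2 * (i : ℤ) - 12)
                    + (((n : ℚ) - 6) / 2 - (i : ℚ)) * (q : ℚ) ^ ((n : ℤ) - 2 * (i : ℤ) - 7)))
              + ∑ i ∈ Finset.Icc 2 (min (SubspaceCodes.floorHalf q + 2)
                    (SubspaceCodes.ceilHalf (n - 5) - 1)),
                  ((i : ℚ) * (q : ℚ) ^ (2 * (n : ℤ) - 2 * (i : ℤ) - 13)
                    + (((n : ℚ) - 6) / 2 - (i : ℚ)) * (q : ℚ) ^ ((n : ℤ) - 2 * (i : ℤ) - 8)))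
          + (Astar : ℚ)) ∧
      (Odd n →
        (C.ncard : ℚ) =
          (q : ℚ) ^ (4 * ((n : ℤ) - 5))
          + ((q : ℚ) ^ (2 * (n : ℤ) - 10) + (q : ℚ) ^ (2 * (n : ℤ) - 14))
            * ((q : ℚ) ^ (2 * (n : ℤ) - 14) + ((n : ℚ) - 9) / 2 * (q : ℚ) ^ ((n : ℤ) - 8)
              + (q : ℚ) ^ (((n : ℤ) - 9) / 2))
          + ((q : ℚ) ^ (2 * (n : ℤ) - 11) + (q : ℚ) ^ (2 * (n : ℤ) - 13))
            * (((n : ℚ) - 9) / 2 * (q : ℚ) ^ ((n : ℤ) - 9) + (q : ℚ) ^ (2 * (n : ℤ) - 15)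
              + (q : ℚ) ^ ((n : ℤ) - 8))
          + ((q : ℚ) ^ (2 * (n : ℤ) - 12) + (q : ℚ) ^ (2 * (n : ℤ) - 13))
            * (2 * (q : ℚ) ^ (2 * (n : ℤ) - 16)
              + ((n : ℚ) - 11) / 2 * (q : ℚ) ^ ((n : ℤ) - 10)
              + (q : ℚ) ^ (((n : ℤ) - 11) / 2))
          + ((q : ℚ) ^ (2 * (n : ℤ) - 12) + (q : ℚ) ^ (2 * (n : ℤ) - 14))
            * ((∑ i ∈ Finset.Icc 3 (min (SubspaceCodes.ceilHalf q + 2)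
                    (SubspaceCodes.floorHalf (n - 5))),
                  ((i : ℚ) * (q : ℚ) ^ (2 * (n : ℤ) - 2 * (i : ℤ) - 12)
                    + (((n : ℚ) - 7) / 2 - (i : ℚ)) * (q : ℚ) ^ ((n : ℤ) - 2 * (i : ℤ) - 6)
                    + (q : ℚ) ^ (((n : ℤ) - 7) / 2 - (i : ℤ))))
              + ∑ i ∈ Finset.Icc 2 (min (SubspaceCodes.floorHalf q + 2)
                    (SubspaceCodes.ceilHalf (n - 5) - 1)),
                  ((i : ℚ) * (q : ℚ) ^ (2 * (n : ℤ) - 2 * (i : ℤ) - 13)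
                    + (((n : ℚ) - 7) / 2 - (i : ℚ)) * (q : ℚ) ^ ((n : ℤ) - 2 * (i : ℤ) - 7)
                    + (q : ℚ) ^ ((n : ℤ) - (i : ℤ) - 7)))
          + (Astar : ℚ)) := by
  refine ⟨SubspaceCodes.exists_isConstructionC5 hn D, fun C hC => ?_⟩
  obtain ⟨hdim, hinf, ⟨X, hX, Y, hY, hXY, h3⟩, hcard⟩ :=
    SubspaceCodes.parameters_of_isConstructionC5 hn hD hDdist hC
  subst hq hA
  have hq0 : Nat.card F ≠ 0 := Nat.card_pos.ne'
  have hC0 : ((Nat.card F ^ (4 * (n - 5)) : ℕ) : ℚ) =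
      (Nat.card F : ℚ) ^ (4 * ((n : ℤ) - 5)) := by
    rw [Nat.cast_pow, ← zpow_natCast]
    congr 1
    omega
  have hcard' := congrArg (Nat.cast (R := ℚ)) hcard
  rw [Nat.cast_add, Nat.cast_add, hC0, SubspaceCodes.sum_indices_eq_sum_classSum hq0 hn]
    at hcard'
  refine ⟨hdim, ⟨⟨X, hX, Y, hY, hXY, ?_⟩, ?_⟩, fun hev => ?_, fun hodd => ?_⟩
  · rw [SubspaceCodes.subspaceDist_of_finrank_eq_five (hdim X hX) (hdim Y hY)]
    have := hinf X hX Y hY hXY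
    omega
  · rintro _ ⟨X, hX, Y, hY, hXY, rfl⟩
    rw [SubspaceCodes.subspaceDist_of_finrank_eq_five (hdim X hX) (hdim Y hY)]
    have := hinf X hX Y hY hXY
    omega
  · have key := SubspaceCodes.sum_classSum hn _ _
      (fun P i => SubspaceCodes.classSum_ceilHalf_add_even hq0 hn hev P)
      (fun P i => SubspaceCodes.classSum_succ_even hq0 hn hev P)
    rw [hcard', key,
      show 2 * (n : ℤ) - 2 * ((1 : ℕ) : ℤ) - 12 = 2 * (n - 7) by push_cast; ring,
      show (n : ℤ) - 2 * ((1 : ℕ) : ℤ) - 7 = n - 9 by push_cast; ring,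
      show 2 * (n : ℤ) - 2 * ((1 : ℕ) : ℤ) - 13 = 2 * n - 15 by push_cast; ring,
      show (n : ℤ) - 2 * ((1 : ℕ) : ℤ) - 8 = n - 10 by push_cast; ring,
      show 2 * (n : ℤ) - 2 * ((2 : ℕ) : ℤ) - 12 = 2 * (n - 8) by push_cast; ring,
      show (n : ℤ) - 2 * ((2 : ℕ) : ℤ) - 7 = n - 11 by push_cast; ring]
    push_cast
    ring
  · have key := SubspaceCodes.sum_classSum hn _ _
      (fun P i => SubspaceCodes.classSum_ceilHalf_add_odd hq0 hn hodd P)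
      (fun P i => SubspaceCodes.classSum_succ_odd hq0 hn hodd P)
    rw [hcard', key,
      show 2 * (n : ℤ) - 2 * ((1 : ℕ) : ℤ) - 12 = 2 * n - 14 by push_cast; ring,
      show (n : ℤ) - 2 * ((1 : ℕ) : ℤ) - 6 = n - 8 by push_cast; ring,
      show ((n : ℤ) - 7) / 2 - ((1 : ℕ) : ℤ) = (n - 9) / 2 by push_cast; omega,
      show 2 * (n : ℤ) - 2 * ((1 : ℕ) : ℤ) - 13 = 2 * n - 15 by push_cast; ring,
      show (n : ℤ) - 2 * ((1 : ℕ) : ℤ) - 7 = n - 9 by push_cast; ring,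
      show (n : ℤ) - ((1 : ℕ) : ℤ) - 7 = n - 8 by push_cast; ring,
      show 2 * (n : ℤ) - 2 * ((2 : ℕ) : ℤ) - 12 = 2 * n - 16 by push_cast; ring,
      show (n : ℤ) - 2 * ((2 : ℕ) : ℤ) - 6 = n - 10 by push_cast; ring,
      show ((n : ℤ) - 7) / 2 - ((2 : ℕ) : ℤ) = (n - 11) / 2 by push_cast; omega]
    push_cast
    ring
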